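/- Let $\mathbb F$ be an algebraically closed field, $V$ a finite-dimensional vector space over $\mathbb F$, and $d\ge 3$. A Leonard pair on $V$ is an ordered pair $A,A^*$ of linear maps $V\to V$ such that in some basis of $V$ the matrix of $A$ is irreducible tridiagonal and that of $A^*$ is diagonal, and in some basis the matrix of $A^*$ is irreducible tridiagonal and that of $A$ is diagonal. Then $A$ and $A^*$ are diagonalizable with one-dimensional eigenspaces. An ordering of the eigenvalues of $A$ (resp. $A^*$) is standard if the matrix of $A^*$ (resp. $A$) in a correspondingly ordered eigenbasis is irreducible tridiagonal. The primitive idempotent associated with an eigenvalue is the projection onto its eigenspace along the sum of the other eigenspaces. Let $\Phi=(A;\{E_i\}_{i=0}^d;A^*;\{E^*_i\}_{i=0}^d)$ be a Leonard system on $V$: $A,A^*$ is a Leonard pair on $V$, and $\{E_i\}$, $\{E_i^*\}$ are the primitive idempotents of $A$, $A^*$ in standard orderings. Let $\theta_i$, $\theta_i^*$ be the eigenvalues of $A$, $A^*$ associated with $E_i$, $E_i^*$. For $0\ne u\in E_0^*V$ the vectors $u_i=(A-\theta_0I)\cdots(A-\theta_{i-1}I)u$ $(0\le i\le d)$ form a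 basis of $V$, in which the matrix of $A^*$ is upper bidiagonal with diagonal $\theta_0^*,\dots,\theta_d^*$ and superdiagonal $\varphi_1,\dots,\varphi_d$ (the first split sequence of $\Phi$). The second split sequence $\phi_1,\dots,\phi_d$ of $\Phi$ is the first split sequence of $(A;\{E_{d-i}\}_{i=0}^d;A^*;\{E_i^*\}_{i=0}^d)$. The zero diagonal space of $\Phi$ is $$\mathcal Z(\Phi)=\{X\in\mathrm{Span}\{I,A^*,A,AA^*\} : E_i^*XE_i^*=0\ \ (0\le i\le d)\}.$$ In the types below, formulas for $\theta_i,\theta_i^*$ are required for $0\le i\le d$ and formulas for $\varphi_i,\phi_i$ for $1\le i\le d$. **$q$-Racah type** with parameters $q,h,h^*,s,s^*,r_1,r_2\in\mathbb F$: all are nonzero; $r_1r_2=ss^*q^{d+1}$; none of $q^i,r_1q^i,r_2q^i,s^*q^i/r_1,s^*q^i/r_2$ is $1$ for $1\le i\le d$; $sq^i\ne1$ and $s^*q^i\neq1$ for $2\le i\le 2d$; and $\theta_i=\theta_0+h(1-q^i)(1-sq^{i+1})q^{-i}$, $\theta^*_i=\theta^*_0+h^*(1-q^i)(1-s^*q^{i+1})q^{-i}$,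 $\varphi_i=hh^*q^{1-2i}(1-q^i)(1-q^{i-d-1})(1-r_1q^i)(1-r_2q^i)$, $\phi_i=hh^*q^{1-2i}(1-q^i)(1-q^{i-d-1})(r_1-s^*q^i)(r_2-s^*q^i)/s^*$. **$q$-Hahn type** with parameters $q,h,h^*,s^*,r\in\mathbb F$: all are nonzero; none of $q^i,rq^i,s^*q^i/r$ is $1$ for $1\le i\le d$; $s^*q^i\ne1$ for $2\le i\le 2d$; and $\theta_i=\theta_0+h(1-q^i)q^{-i}$, $\theta^*_i=\theta^*_0+h^*(1-q^i)(1-s^*q^{i+1})q^{-i}$, $\varphi_i=hh^*q^{1-2i}(1-q^i)(1-q^{i-d-1})(1-rq^i)$, $\phi_i=-hh^*q^{1-i}(1-q^i)(1-q^{i-d-1})(r-s^*q^i)$. **Racah type** with parameters $h,h^*,s,s^*,r_1,r_2\in\mathbb F$: $h,h^*\ne0$; $r_1+r_2=s+s^*+d+1$; $\mathrm{char}\,\mathbb F$ is $0$ or a prime greater than $d$; none of $r_1,r_2,s^*-r_1,s^*-r_2$ is $-i$ for $1\le i\le d$; $s\neq-i$ and $s^*\ne-i$ for $2\le i\le2d$;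 and $\theta_i=\theta_0+hi(i+1+s)$, $\theta^*_i=\theta^*_0+h^*i(i+1+s^*)$, $\varphi_i=hh^*i(i-d-1)(i+r_1)(i+r_2)$, $\phi_i=hh^*i(i-d-1)(i+s^*-r_1)(i+s^*-r_2)$. **Bannai/Ito type** with parameters $h,h^*,s,s^*,r_1,r_2\in\mathbb F$: $h,h^*\ne0$; $\mathrm{char}\,\mathbb F$ is $0$ or an odd prime greater than $d/2$; $r_1+r_2=-s-s^*+d+1$; neither of $r_1,-s^*-r_1$ is $-i$ for $1\le i\le d$ with $d-i$ even; neither of $r_2,-s^*-r_2$ is $-i$ for $1\le i\le d$ with $i$ odd; neither of $s,s^*$ is $2i$ for $1\le i\le d$; and $\theta_i=\theta_0+h(s-1+(1-s+2i)(-1)^i)$, $\theta^*_i=\theta^*_0+h^*(s^*-1+(1-s^*+2i)(-1)^i)$, $$\varphi_i=\begin{cases}-4hh^*i(i+r_1)& i\text{ even},\ d\text{ even}\\-4hh^*(i-d-1)(i+r_2)& i\text{ odd},\ d\text{ even}\\-4hh^*i(i-d-1)& i\text{ even},\ d\text{ odd}\\-4hh^*(i+r_1)(i+r_2)& i\text{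 odd},\ d\text{ odd,}\end{cases}$$ $$\phi_i=\begin{cases}4hh^*i(i-s^*-r_1)& i\text{ even},\ d\text{ even}\\4hh^*(i-d-1)(i-s^*-r_2)& i\text{ odd},\ d\text{ even}\\-4hh^*i(i-d-1)& i\text{ even},\ d\text{ odd}\\-4hh^*(i-s^*-r_1)(i-s^*-r_2)& i\text{ odd},\ d\text{ odd.}\end{cases}$$ **Theorem.** - If $\Phi$ has $q$-Racah type with parameters $q,h,h^*,s,s^*,r_1,r_2$, then $\mathcal Z(\Phi)\ne0$ if and only if $s^*=r_1^2$ or $s^*=r_2^2$. - If $\Phi$ has $q$-Hahn type with parameters $q,h,h^*,s^*,r$, then $\mathcal Z(\Phi)\ne0$ if and only if $s^*=r^2$. - If $\Phi$ has Racah type with parameters $h,h^*,s,s^*,r_1,r_2$, then $\mathcal Z(\Phi)\ne0$ if and only if $s^*=2r_1$ or $s^*=2r_2$. - If $\Phi$ has Bannai/Ito type with parameters $h,h^*,s,s^*,r_1,r_2$, then $\mathcal Z(\Phi)\ne0$ if and only if $s^*=-2r_1$ or $s^*=-2r_2$. -/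

import Mathlib

/-- A square matrix is irreducible tridiagonal: every nonzero entry lies on the diagonal, the
subdiagonal or the superdiagonal, and all entries of the sub- and superdiagonal are nonzero. -/
structure IsIrreducibleTridiagonal {F : Type*} [Field F] {n : ℕ}
    (M : Matrix (Fin n) (Fin n) F) : Prop where
  tridiagonal : ∀ i j : Fin n, (i : ℕ) + 1 < j ∨ (j : ℕ) + 1 < i → M i j = 0
  irreducible : ∀ i j : Fin n, (i : ℕ) + 1 = j ∨ (j : ℕ) + 1 = i → M i j ≠ 0

/-- Leonard pairs on `V`. -/
structure IsLeonardPair {F V : Type*} [Field F] [AddCommGroup V] [Module F V]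
    (A As : Module.End F V) : Prop where
  left : ∃ (n : ℕ) (b : Module.Basis (Fin n) F V),
    IsIrreducibleTridiagonal (LinearMap.toMatrix b b A) ∧ (LinearMap.toMatrix b b As).IsDiag
  right : ∃ (n : ℕ) (b : Module.Basis (Fin n) F V),
    IsIrreducibleTridiagonal (LinearMap.toMatrix b b As) ∧ (LinearMap.toMatrix b b A).IsDiag

/-- `θ 0, …, θ d` is an ordering, without repetition, of the eigenvalues of `A`. -/
structure IsEigenvalueOrdering {F V : Type*} [Field F] [AddCommGroup V] [Module F V] {d : ℕ}
    (A : Module.End F V) (θ : Fin (d + 1) → F) : Prop where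
  injective : Function.Injective θ
  hasEigenvalue_iff : ∀ μ : F, A.HasEigenvalue μ ↔ ∃ i, θ i = μ

/-- The ordering `θ 0, …, θ d` of the eigenvalues of `A` is standard (with respect to `As`):
corresponding eigenvectors form a basis with respect to which `As` is irreducible tridiagonal
(and `A` is diagonal, with diagonal entries `θ 0, …, θ d`). -/
structure IsStandardOrdering {F V : Type*} [Field F] [AddCommGroup V] [Module F V] {d : ℕ}
    (A As : Module.End F V) (θ : Fin (d + 1) → F) : Prop where
  ordering : IsEigenvalueOrdering A θ
  standard : ∃ v : Module.Basis (Fin (d + 1)) F V,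
    (∀ i, A (v i) = θ i • v i) ∧ IsIrreducibleTridiagonal (LinearMap.toMatrix v v As)

/-- For a diagonalizable map `A`, `E` is the primitive idempotent of `A` associated with the
eigenvalue `μ`: it is the identity on the `μ`-eigenspace and zero on all other eigenspaces. -/
structure IsPrimitiveIdempotent {F V : Type*} [Field F] [AddCommGroup V] [Module F V]
    (A : Module.End F V) (μ : F) (E : Module.End F V) : Prop where
  hasEigenvalue : A.HasEigenvalue μ
  apply_self : ∀ v ∈ A.eigenspace μ, E v = v
  apply_other : ∀ ν : F, ν ≠ μ → ∀ v ∈ A.eigenspace ν, E v = 0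

/-- `E 0, …, E d` is a standard ordering of the primitive idempotents of `A`
(with respect to `As`). -/
def IsStandardIdempotentOrdering {F V : Type*} [Field F] [AddCommGroup V] [Module F V] {d : ℕ}
    (A As : Module.End F V) (E : Fin (d + 1) → Module.End F V) : Prop :=
  ∃ θ : Fin (d + 1) → F, IsStandardOrdering A As θ ∧ ∀ i, IsPrimitiveIdempotent A (θ i) (E i)

/-- Leonard systems `(A; {E_i}; A^*; {E^*_i})` on `V`, of diameter `d`. -/
structure LeonardSystem (F V : Type*) [Field F] [AddCommGroup V] [Module F V] (d : ℕ) where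
  A : Module.End F V
  E : Fin (d + 1) → Module.End F V
  As : Module.End F V
  Es : Fin (d + 1) → Module.End F V
  leonardPair : IsLeonardPair A As
  standard : IsStandardIdempotentOrdering A As E
  standard_dual : IsStandardIdempotentOrdering As A Es

/-- Reversing a standard ordering of the primitive idempotents gives a standard ordering. -/
theorem IsStandardIdempotentOrdering.rev {F V : Type*} [Field F] [AddCommGroup V] [Module F V]
    {d : ℕ} {A As : Module.End F V} {E : Fin (d + 1) → Module.End F V}
    (h : IsStandardIdempotentOrdering A As E) :
    IsStandardIdempotentOrdering A As (fun i => E i.rev) := by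
  obtain ⟨θ, ⟨⟨hinj, hev⟩, v, hv, htri⟩, hE⟩ := h
  refine ⟨fun i => θ i.rev, ⟨⟨hinj.comp Fin.rev_injective, fun μ => ?_⟩,
    v.reindex Fin.revPerm, fun i => ?_, ⟨fun i j hij => ?_, fun i j hij => ?_⟩⟩,
    fun i => hE i.rev⟩
  · rw [hev]
    exact ⟨fun ⟨i, hi⟩ => ⟨i.rev, by simpa using hi⟩, fun ⟨i, hi⟩ => ⟨i.rev, hi⟩⟩
  · simpa using hv i.rev
  · have := htri.tridiagonal i.rev j.rev (by simp only [Fin.val_rev]; omega)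
    simpa [LinearMap.toMatrix_apply] using this
  · have := htri.irreducible i.rev j.rev (by simp only [Fin.val_rev]; omega)
    simpa [LinearMap.toMatrix_apply] using this

namespace LeonardSystem

/-- The Leonard system `Φ^⇓ = (A; {E_{d-i}}; A^*; {E^*_i})`. -/
def doubleDown {F V : Type*} [Field F] [AddCommGroup V] [Module F V] {d : ℕ}
    (Φ : LeonardSystem F V d) : LeonardSystem F V d where
  A := Φ.A
  E := fun i => Φ.E i.rev
  As := Φ.As
  Es := Φ.Es
  leonardPair := Φ.leonardPair
  standard := Φ.standard.rev
  standard_dual := Φ.standard_dual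

/-- `θ` is the eigenvalue sequence of `Φ`: `θ i` is the eigenvalue of `A` associated
with `E i`. -/
def IsEigenvalueSequence {F V : Type*} [Field F] [AddCommGroup V] [Module F V] {d : ℕ}
    (Φ : LeonardSystem F V d) (θ : Fin (d + 1) → F) : Prop :=
  ∀ i, IsPrimitiveIdempotent Φ.A (θ i) (Φ.E i)

/-- `θs` is the dual eigenvalue sequence of `Φ`: `θs i` is the eigenvalue of `A^*` associated
with `Es i`. -/
def IsDualEigenvalueSequence {F V : Type*} [Field F] [AddCommGroup V] [Module F V] {d : ℕ}
    (Φ : LeonardSystem F V d) (θs : Fin (d + 1) → F) : Prop :=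
  ∀ i, IsPrimitiveIdempotent Φ.As (θs i) (Φ.Es i)

/-- `u 0, …, u d` is a `Φ`-split basis: `u i = (A - θ_0 I) ⋯ (A - θ_{i-1} I) x` for a nonzero
vector `x` of `E^*_0 V`, where `θ` is the eigenvalue sequence of `Φ`. -/
def IsSplitBasis {F V : Type*} [Field F] [AddCommGroup V] [Module F V] {d : ℕ}
    (Φ : LeonardSystem F V d) (u : Module.Basis (Fin (d + 1)) F V) : Prop :=
  ∃ θ : Fin (d + 1) → F, Φ.IsEigenvalueSequence θ ∧
    ∃ x ∈ LinearMap.range (Φ.Es 0), x ≠ 0 ∧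
      ∀ i, u i = Polynomial.aeval Φ.A
        (∏ j ∈ Finset.Iio i, (Polynomial.X - Polynomial.C (θ j))) x

/-- `φ 1, …, φ d` is the first split sequence of `Φ`: with respect to a `Φ`-split basis, the
matrix representing `A^*` is upper bidiagonal, with diagonal entries the dual eigenvalues and
superdiagonal entries `φ 1, …, φ d`. (The values of `φ` outside `1, …, d` play no role.) -/
def IsFirstSplitSequence {F V : Type*} [Field F] [AddCommGroup V] [Module F V] {d : ℕ}
    (Φ : LeonardSystem F V d) (φ : ℕ → F) : Prop :=
  ∃ θs : Fin (d + 1) → F, Φ.IsDualEigenvalueSequence θs ∧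
    ∃ u : Module.Basis (Fin (d + 1)) F V, Φ.IsSplitBasis u ∧
      LinearMap.toMatrix u u Φ.As =
        Matrix.of fun i j : Fin (d + 1) =>
          if i = j then θs i else if (i : ℕ) + 1 = j then φ j else 0

/-- The second split sequence of `Φ` is the first split sequence of `Φ^⇓`. -/
def IsSecondSplitSequence {F V : Type*} [Field F] [AddCommGroup V] [Module F V] {d : ℕ}
    (Φ : LeonardSystem F V d) (ϕ : ℕ → F) : Prop :=
  Φ.doubleDown.IsFirstSplitSequence ϕ

/-- `(θ; θs; φ; ϕ)` is the parameter array of `Φ`, where `φ` and `ϕ` are indexed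
by `1, …, d`. -/
structure IsParameterArray {F V : Type*} [Field F] [AddCommGroup V] [Module F V] {d : ℕ}
    (Φ : LeonardSystem F V d) (θ θs : Fin (d + 1) → F) (φ ϕ : ℕ → F) : Prop where
  eigenvalue : Φ.IsEigenvalueSequence θ
  dualEigenvalue : Φ.IsDualEigenvalueSequence θs
  firstSplit : Φ.IsFirstSplitSequence φ
  secondSplit : Φ.IsSecondSplitSequence ϕ

/-- The zero diagonal space of `Φ`: the elements `X` of `Span {I, A^*, A, A A^*}` such that
`E^*_i X E^*_i = 0` for all `i`. -/
def zeroDiagonalSpace {F V : Type*} [Field F] [AddCommGroup V] [Module F V] {d : ℕ}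
    (Φ : LeonardSystem F V d) : Submodule F (Module.End F V) where
  carrier := {X | X ∈ Submodule.span F {1, Φ.As, Φ.A, Φ.A * Φ.As} ∧
    ∀ i, Φ.Es i * X * Φ.Es i = 0}
  add_mem' := fun {X Y} hX hY =>
    ⟨add_mem hX.1 hY.1, fun i => by rw [mul_add, add_mul, hX.2 i, hY.2 i, add_zero]⟩
  zero_mem' := ⟨zero_mem _, fun i => by rw [mul_zero, zero_mul]⟩
  smul_mem' := fun c X hX =>
    ⟨Submodule.smul_mem _ c hX.1, fun i => by
      rw [mul_smul_comm, smul_mul_assoc, hX.2 i, smul_zero]⟩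

/-- `Φ` has `q`-Racah type, with parameters `q, h, h^*, s, s^*, r_1, r_2`. -/
structure HasQRacahType {F V : Type*} [Field F] [AddCommGroup V] [Module F V] {d : ℕ}
    (Φ : LeonardSystem F V d) (q h hs s ss r₁ r₂ : F) : Prop where
  ne_zero : q ≠ 0 ∧ h ≠ 0 ∧ hs ≠ 0 ∧ s ≠ 0 ∧ ss ≠ 0 ∧ r₁ ≠ 0 ∧ r₂ ≠ 0
  rel : r₁ * r₂ = s * ss * q ^ (d + 1)
  ne_one : ∀ i : ℕ, 1 ≤ i → i ≤ d → q ^ i ≠ 1 ∧ r₁ * q ^ i ≠ 1 ∧ r₂ * q ^ i ≠ 1 ∧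
    ss * q ^ i / r₁ ≠ 1 ∧ ss * q ^ i / r₂ ≠ 1
  ne_one' : ∀ i : ℕ, 2 ≤ i → i ≤ 2 * d → s * q ^ i ≠ 1 ∧ ss * q ^ i ≠ 1
  array : ∃ (θ θs : Fin (d + 1) → F) (φ ϕ : ℕ → F), Φ.IsParameterArray θ θs φ ϕ ∧
    (∀ i : Fin (d + 1), θ i = θ 0 +
      h * (1 - q ^ (i : ℕ)) * (1 - s * q ^ ((i : ℕ) + 1)) * q ^ (-((i : ℕ) : ℤ))) ∧
    (∀ i : Fin (d + 1), θs i = θs 0 +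
      hs * (1 - q ^ (i : ℕ)) * (1 - ss * q ^ ((i : ℕ) + 1)) * q ^ (-((i : ℕ) : ℤ))) ∧
    (∀ i : ℕ, 1 ≤ i → i ≤ d → φ i =
      h * hs * q ^ (1 - 2 * (i : ℤ)) * (1 - q ^ i) * (1 - q ^ ((i : ℤ) - d - 1)) *
        (1 - r₁ * q ^ i) * (1 - r₂ * q ^ i)) ∧
    (∀ i : ℕ, 1 ≤ i → i ≤ d → ϕ i =
      h * hs * q ^ (1 - 2 * (i : ℤ)) * (1 - q ^ i) * (1 - q ^ ((i : ℤ) - d - 1)) *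
        (r₁ - ss * q ^ i) * (r₂ - ss * q ^ i) / ss)

/-- `Φ` has `q`-Hahn type, with parameters `q, h, h^*, s^*, r`. -/
structure HasQHahnType {F V : Type*} [Field F] [AddCommGroup V] [Module F V] {d : ℕ}
    (Φ : LeonardSystem F V d) (q h hs ss r : F) : Prop where
  ne_zero : q ≠ 0 ∧ h ≠ 0 ∧ hs ≠ 0 ∧ ss ≠ 0 ∧ r ≠ 0
  ne_one : ∀ i : ℕ, 1 ≤ i → i ≤ d → q ^ i ≠ 1 ∧ r * q ^ i ≠ 1 ∧ ss * q ^ i / r ≠ 1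
  ne_one' : ∀ i : ℕ, 2 ≤ i → i ≤ 2 * d → ss * q ^ i ≠ 1
  array : ∃ (θ θs : Fin (d + 1) → F) (φ ϕ : ℕ → F), Φ.IsParameterArray θ θs φ ϕ ∧
    (∀ i : Fin (d + 1), θ i = θ 0 + h * (1 - q ^ (i : ℕ)) * q ^ (-((i : ℕ) : ℤ))) ∧
    (∀ i : Fin (d + 1), θs i = θs 0 +
      hs * (1 - q ^ (i : ℕ)) * (1 - ss * q ^ ((i : ℕ) + 1)) * q ^ (-((i : ℕ) : ℤ))) ∧
    (∀ i : ℕ, 1 ≤ i → i ≤ d → φ i =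
      h * hs * q ^ (1 - 2 * (i : ℤ)) * (1 - q ^ i) * (1 - q ^ ((i : ℤ) - d - 1)) *
        (1 - r * q ^ i)) ∧
    (∀ i : ℕ, 1 ≤ i → i ≤ d → ϕ i =
      -(h * hs * q ^ (1 - (i : ℤ)) * (1 - q ^ i) * (1 - q ^ ((i : ℤ) - d - 1)) *
        (r - ss * q ^ i)))

/-- `Φ` has Racah type, with parameters `h, h^*, s, s^*, r_1, r_2`. -/
structure HasRacahType {F V : Type*} [Field F] [AddCommGroup V] [Module F V] {d : ℕ}
    (Φ : LeonardSystem F V d) (h hs s ss r₁ r₂ : F) : Prop where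
  ne_zero : h ≠ 0 ∧ hs ≠ 0
  rel : r₁ + r₂ = s + ss + d + 1
  char : ringChar F = 0 ∨ ((ringChar F).Prime ∧ d < ringChar F)
  ne_neg : ∀ i : ℕ, 1 ≤ i → i ≤ d →
    r₁ ≠ -(i : F) ∧ r₂ ≠ -(i : F) ∧ ss - r₁ ≠ -(i : F) ∧ ss - r₂ ≠ -(i : F)
  ne_neg' : ∀ i : ℕ, 2 ≤ i → i ≤ 2 * d → s ≠ -(i : F) ∧ ss ≠ -(i : F)
  array : ∃ (θ θs : Fin (d + 1) → F) (φ ϕ : ℕ → F), Φ.IsParameterArray θ θs φ ϕ ∧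
    (∀ i : Fin (d + 1), θ i = θ 0 + h * ((i : ℕ) : F) * (((i : ℕ) : F) + 1 + s)) ∧
    (∀ i : Fin (d + 1), θs i = θs 0 + hs * ((i : ℕ) : F) * (((i : ℕ) : F) + 1 + ss)) ∧
    (∀ i : ℕ, 1 ≤ i → i ≤ d → φ i =
      h * hs * (i : F) * ((i : F) - d - 1) * ((i : F) + r₁) * ((i : F) + r₂)) ∧
    (∀ i : ℕ, 1 ≤ i → i ≤ d → ϕ i =
      h * hs * (i : F) * ((i : F) - d - 1) * ((i : F) + ss - r₁) * ((i : F) + ss - r₂))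

/-- `Φ` has Bannai/Ito type, with parameters `h, h^*, s, s^*, r_1, r_2`. For `1 ≤ i ≤ d` the
number `d - i` is even if and only if `d + i` is even. -/
structure HasBannaiItoType {F V : Type*} [Field F] [AddCommGroup V] [Module F V] {d : ℕ}
    (Φ : LeonardSystem F V d) (h hs s ss r₁ r₂ : F) : Prop where
  ne_zero : h ≠ 0 ∧ hs ≠ 0
  char : ringChar F = 0 ∨ ((ringChar F).Prime ∧ Odd (ringChar F) ∧ d < 2 * ringChar F)
  rel : r₁ + r₂ = -s - ss + d + 1
  ne_neg₁ : ∀ i : ℕ, 1 ≤ i → i ≤ d → Even (d + i) → r₁ ≠ -(i : F) ∧ -ss - r₁ ≠ -(i : F)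
  ne_neg₂ : ∀ i : ℕ, 1 ≤ i → i ≤ d → Odd i → r₂ ≠ -(i : F) ∧ -ss - r₂ ≠ -(i : F)
  ne_two_mul : ∀ i : ℕ, 1 ≤ i → i ≤ d → s ≠ 2 * (i : F) ∧ ss ≠ 2 * (i : F)
  array : ∃ (θ θs : Fin (d + 1) → F) (φ ϕ : ℕ → F), Φ.IsParameterArray θ θs φ ϕ ∧
    (∀ i : Fin (d + 1), θ i = θ 0 +
      h * (s - 1 + (1 - s + 2 * ((i : ℕ) : F)) * (-1) ^ (i : ℕ))) ∧
    (∀ i : Fin (d + 1), θs i = θs 0 +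
      hs * (ss - 1 + (1 - ss + 2 * ((i : ℕ) : F)) * (-1) ^ (i : ℕ))) ∧
    (∀ i : ℕ, 1 ≤ i → i ≤ d →
      (Even i → Even d → φ i = -4 * h * hs * (i : F) * ((i : F) + r₁)) ∧
      (Odd i → Even d → φ i = -4 * h * hs * ((i : F) - d - 1) * ((i : F) + r₂)) ∧
      (Even i → Odd d → φ i = -4 * h * hs * (i : F) * ((i : F) - d - 1)) ∧
      (Odd i → Odd d → φ i = -4 * h * hs * ((i : F) + r₁) * ((i : F) + r₂))) ∧
    (∀ i : ℕ, 1 ≤ i → i ≤ d →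
      (Even i → Even d → ϕ i = 4 * h * hs * (i : F) * ((i : F) - ss - r₁)) ∧
      (Odd i → Even d → ϕ i = 4 * h * hs * ((i : F) - d - 1) * ((i : F) - ss - r₂)) ∧
      (Even i → Odd d → ϕ i = -4 * h * hs * (i : F) * ((i : F) - d - 1)) ∧
      (Odd i → Odd d → ϕ i = -4 * h * hs * ((i : F) - ss - r₁) * ((i : F) - ss - r₂)))

end LeonardSystem

/-! Write `a i` for the scalar with `Es i * A * Es i = a i • Es i`. Compressing x₀I + x₁A* + x₂A +
x₃AA* by `Es i` gives the scalar x₀ + x₁θ*ᵢ + x₂aᵢ + x₃aᵢθ*ᵢ. Since I, A*, A, AA* are linearly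
independent, the zero diagonal space is nonzero exactly when the functions 1, θ*, a, aθ* of i are
dependent (`zeroDiagonalSpace_ne_bot_iff`). The split basis yields aᵢ = θᵢ + Wᵢ − Wᵢ₊₁ with Wₖ =
φₖ/(θ*ₖ − θ*ₖ₋₁) and W₀ = W_{d+1} = 0 (`exists_compression`).

Let t be θ* after an affine normalisation. Up to an additive constant, a is (mt + ρ)/(t² − κ²) in
the q-Racah and Bannai/Ito cases and αt + ρ/(4t − κ) with α ≠ 0 in the Racah case. A dependence,
multiplied by the denominator, is a polynomial of degree at most 3 in t with at least four roots, so
it vanishes identically. This forces a pole to be removable (`not_bilinearlyRelated_of_two_poles`,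
`not_bilinearlyRelated_of_one_pole`).

The numerators at the poles split into linear factors. Some vanish exactly under the stated
conditions on r₁, r₂; a common factor then cancels from W and an explicit dependence appears. The
others vanish only when the pole is the value of t at i = 0 or i = d. There the rational formula
says nothing, and the true value of a, found from W₀ = 0 or W_{d+1} = 0, differs from the continued
one, so no dependence arises. The q-Hahn case is the q-Racah computation with s = r₂ = 0. -/

open Finset

/-! ### Diagonal entries of A computed from a split basis -/

section SplitBasis

variable {F V : Type*} [Field F] [AddCommGroup V] [Module F V]

theorem IsPrimitiveIdempotent.eigenvalue_unique {A E : Module.End F V} {μ ν : F}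
    (h : IsPrimitiveIdempotent A μ E) (h' : IsPrimitiveIdempotent A ν E) : μ = ν := by
  by_contra hne
  obtain ⟨v, hv⟩ := h.hasEigenvalue.exists_hasEigenvector
  exact hv.2 ((h.apply_self v hv.1).symm.trans (h'.apply_other μ hne v hv.1))

/-- Extension by zero of a family indexed by `Fin n`. -/
def extendFin {α : Type*} [Zero α] {n : ℕ} (f : Fin n → α) (k : ℕ) : α :=
  if h : k < n then f ⟨k, h⟩ else 0

theorem extendFin_val {α : Type*} [Zero α] {n : ℕ} (f : Fin n → α) (i : Fin n) :
    extendFin f i = f i := by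
  simp [extendFin]

theorem sum_upper_bidiagonal {M : Type*} [AddCommMonoid M] [Module F M] {d : ℕ}
    (D : Fin (d + 1) → F) (φ : ℕ → F) (c : Fin (d + 1) → M) (k : Fin (d + 1)) :
    ∑ j, (if k = j then D k else if (k : ℕ) + 1 = j then φ j else 0) • c j =
      D k • c k + φ (k + 1) • extendFin c (k + 1) := by
  have h : ∀ j, (if k = j then D k else if (k : ℕ) + 1 = j then φ j else 0) • c j =
      (if k = j then D k • c j else 0) + if (k : ℕ) + 1 = j then φ j • c j else 0 := by
    intro j
    split_ifs with h1 h2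
    · subst h1; omega
    all_goals simp
  simp_rw [h]
  rw [sum_add_distrib, sum_ite_eq]
  simp only [mem_univ, if_true]
  congr 1
  by_cases hk : (k : ℕ) + 1 < d + 1
  · rw [sum_eq_single ⟨k + 1, hk⟩]
    · simp [extendFin, hk]
    · intro j _ hj
      rw [if_neg]
      intro h; exact hj (Fin.ext h.symm)
    · simp
  · rw [sum_eq_zero, extendFin, dif_neg hk, smul_zero]
    intro j _
    rw [if_neg]
    have := j.2
    omega

/-- The diagonal part of an operator acting bidiagonally on a basis on which `As` is upper
bidiagonal. Here `v` is an eigenvector of `As` and `E` is a projection that is compatible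
with `As`. -/
theorem compress_eigenvector {d : ℕ} {A As E : Module.End F V}
    (u : Module.Basis (Fin (d + 1)) F V) {θ θs : Fin (d + 1) → F} {φ : ℕ → F}
    (hθs : Function.Injective θs)
    (hA : ∀ i, A (u i) = θ i • u i + extendFin u (i + 1))
    (hAs : LinearMap.toMatrix u u As = Matrix.of fun i j : Fin (d + 1) =>
          if i = j then θs i else if (i : ℕ) + 1 = j then φ j else 0)
    (i : Fin (d + 1)) {v : V} (hv : As v = θs i • v) (hEv : E v = v)
    (hE : ∀ w, E (As w) = θs i • E w) {W : ℕ → F} (hW0 : W 0 = 0) (hWd : W (d + 1) = 0)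
    (hW : ∀ (k : ℕ) (hk : k < d),
      W (k + 1) * (θs ⟨k + 1, by omega⟩ - θs ⟨k, by omega⟩) = φ (k + 1)) :
    E (A v) = (θ i + W i - W (i + 1)) • v := by
  have hsum : ∀ j, As (u j) = ∑ k, LinearMap.toMatrix u u As k j • u k := fun j => by
    simp_rw [LinearMap.toMatrix_apply]
    exact (u.sum_repr _).symm
  have hAsu : ∀ (k : ℕ) (hk : k < d), As (u ⟨k + 1, by omega⟩) =
      θs ⟨k + 1, by omega⟩ • u ⟨k + 1, by omega⟩ + φ (k + 1) • u ⟨k, by omega⟩ := by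
    intro k hk
    rw [hsum, hAs]
    rw [sum_eq_add (⟨k + 1, by omega⟩ : Fin (d + 1)) ⟨k, by omega⟩]
    · simp
    · simp
    · intro j _ hj
      simp only [Matrix.of_apply]
      rw [if_neg hj.1, if_neg, zero_smul]
      intro h
      apply hj.2
      ext
      simpa using h
    · simp
    · simp
  have hAs0 : As (u 0) = θs 0 • u 0 := by
    rw [hsum, hAs]
    rw [sum_eq_single 0]
    · simp
    · intro j _ hj
      simp [hj]
    · simp
  set c := u.repr v with hc
  have hcrec : ∀ k : Fin (d + 1), θs k * c k + φ (k + 1) * extendFin c (k + 1) = θs i * c k := by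
    intro k
    have h1 := congrFun (LinearMap.toMatrix_mulVec_repr u u As v) k
    rw [hv, hAs, Matrix.mulVec, dotProduct] at h1
    simp only [Matrix.of_apply, map_smul, Finsupp.smul_apply, smul_eq_mul] at h1
    rw [← h1]
    exact (sum_upper_bidiagonal θs φ (fun j => c j) k).symm
  -- Back substitution, downward from k = d: `As` is upper triangular with distinct diagonal
  -- entries, so its i-th eigenvector lies in the span of u₀, …, uᵢ.
  have hczero : ∀ n : ℕ, ∀ k : Fin (d + 1), (k : ℕ) + n = d → i < k → c k = 0 := by
    intro n
    induction n with
    | zero =>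
      intro k hk hik
      have h1 := hcrec k
      rw [extendFin, dif_neg (by omega), mul_zero, add_zero] at h1
      have h2 : θs k - θs i ≠ 0 := sub_ne_zero.2 fun h => hik.ne' (hθs h)
      exact (mul_eq_zero.1 (by linear_combination h1 : (θs k - θs i) * c k = 0)).resolve_left h2
    | succ n ih =>
      intro k hk hik
      have h1 := hcrec k
      have hk' : (k : ℕ) + 1 < d + 1 := by omega
      rw [extendFin, dif_pos hk', ih ⟨k + 1, hk'⟩ (by simp; omega)
        (by rw [Fin.lt_def] at hik ⊢; simp; omega), mul_zero, add_zero] at h1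
      have h2 : θs k - θs i ≠ 0 := sub_ne_zero.2 fun h => hik.ne' (hθs h)
      exact (mul_eq_zero.1 (by linear_combination h1 : (θs k - θs i) * c k = 0)).resolve_left h2
  have hczero' : ∀ k : Fin (d + 1), i < k → c k = 0 := fun k =>
    hczero (d - k) k (by omega)
  -- The dual fact: `E` is a left eigenvector of `As`, so it kills u₀, …, uᵢ₋₁.
  have hg : ∀ (n : ℕ) (hn : n < d + 1), n < i → E (u ⟨n, hn⟩) = 0 := by
    intro n
    induction n with
    | zero =>
      intro hn hi
      have h1 := hE (u 0)
      rw [hAs0, map_smul] at h1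
      have h2 : θs 0 - θs i ≠ 0 := sub_ne_zero.2 fun h => by
        have := hθs h; subst this; simp at hi
      refine (smul_eq_zero.1 (?_ : (θs 0 - θs i) • E (u 0) = 0)).resolve_left h2
      rw [sub_smul, h1, sub_self]
    | succ n ih =>
      intro hn hi
      have h1 := hE (u ⟨n + 1, hn⟩)
      rw [hAsu n (by omega), map_add, map_smul, map_smul, ih (by omega) (by omega), smul_zero,
        add_zero] at h1
      have h2 : θs ⟨n + 1, hn⟩ - θs i ≠ 0 := sub_ne_zero.2 fun h => by
        have := hθs h; rw [← this] at hi; simp at hi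
      refine (smul_eq_zero.1 (?_ : (θs ⟨n + 1, hn⟩ - θs i) • E (u ⟨n + 1, hn⟩) = 0)).resolve_left h2
      rw [sub_smul, h1, sub_self]
  have hgsucc : E (extendFin u (i + 1)) = -W (i + 1) • E (u i) := by
    by_cases hi : (i : ℕ) + 1 < d + 1
    · rw [extendFin, dif_pos hi]
      have h1 := hE (u ⟨i + 1, hi⟩)
      rw [hAsu i (by omega), map_add, map_smul, map_smul, ← hW i (by omega)] at h1
      have h2 : θs ⟨i + 1, hi⟩ - θs i ≠ 0 := sub_ne_zero.2 fun h => by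
        have := congrArg Fin.val (hθs h); simp at this
      simp only [Fin.eta] at h1
      refine smul_right_injective V h2 ?_
      simp only
      rw [← sub_eq_zero] at h1 ⊢
      rw [← h1]
      module
    · have : (i : ℕ) = d := by omega
      rw [extendFin, dif_neg hi, this, hWd]
      simp
  have hcpred : ∀ (k : ℕ) (hk : k + 1 = i),
      c ⟨k, by omega⟩ = W i * c i := by
    intro k hk
    have h1 := hcrec ⟨k, by omega⟩
    have h2 := hW k (by omega)
    have h3 : (⟨k + 1, by omega⟩ : Fin (d + 1)) = i := Fin.ext hk
    rw [extendFin, dif_pos (by simp; omega)] at h1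
    simp only [h3] at h1 h2
    rw [hk] at h2
    rw [hk, ← h2] at h1
    have h4 : θs i - θs ⟨k, by omega⟩ ≠ 0 := sub_ne_zero.2 fun h => by
      have := congrArg Fin.val (hθs h); simp at this; omega
    apply mul_left_cancel₀ h4
    linear_combination -h1
  have hvsum : ∑ k, c k • u k = v := u.sum_repr v
  have hv1 : c i • E (u i) = v := by
    conv_rhs => rw [← hEv, ← hvsum]
    rw [map_sum, sum_eq_single i]
    · rw [map_smul]
    · intro k _ hk
      rcases lt_or_gt_of_ne hk with h | h
      · rw [map_smul, hg k k.2 h, smul_zero]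
      · rw [hczero' k h, zero_smul, map_zero]
    · simp
  have h5 : ∑ k, (c k * θ k) • E (u k) = (c i * θ i) • E (u i) := by
    rw [sum_eq_single i]
    · intro k _ hk
      rcases lt_or_gt_of_ne hk with h | h
      · rw [hg k k.2 h, smul_zero]
      · rw [hczero' k h, zero_mul, zero_smul]
    · simp
  have h6 : ∀ k : Fin (d + 1), k < i → (k : ℕ) + 1 ≠ i → E (extendFin u (k + 1)) = 0 := by
    intro k hk hk'
    rw [extendFin, dif_pos (by omega)]
    exact hg _ _ (by rw [Fin.lt_def] at hk; omega)
  -- By the two triangularities only k = i − 1 and k = i survive. The first contributes Wᵢ through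
  -- the ratio of consecutive coordinates of `v`, the second −Wᵢ₊₁ through the ratio of consecutive
  -- values of `E`.
  have h7 : ∑ k, c k • E (extendFin u (k + 1)) = ((W i - W (i + 1)) * c i) • E (u i) := by
    rcases Nat.eq_zero_or_eq_succ_pred (i : ℕ) with hi | hi
    · rw [sum_eq_single i, hgsucc, hi, hW0]
      · module
      · intro k _ hk
        rcases lt_or_gt_of_ne hk with h | h
        · rw [Fin.lt_def] at h; omega
        · rw [hczero' k h, zero_smul]
      · simp
    · rw [sum_eq_add (⟨(i : ℕ).pred, by omega⟩ : Fin (d + 1)) i, hgsucc, hcpred _ hi.symm]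
      · simp only
        have h8 : extendFin u ((i : ℕ).pred + 1) = u i := by
          rw [← extendFin_val u i]
          exact congrArg _ hi.symm
        rw [h8]
        module
      · intro h; have := congrArg Fin.val h; simp only at this; omega
      · intro k _ hk
        rcases lt_or_gt_of_ne hk.2 with h | h
        · rw [h6 k h, smul_zero]
          intro h'
          apply hk.1; ext; simp only; omega
        · rw [hczero' k h, zero_smul]
      · simp
      · simp
  calc E (A v) = ∑ k, ((c k * θ k) • E (u k) + c k • E (extendFin u (k + 1))) := by
        conv_lhs => rw [← hvsum]
        simp only [map_sum, map_smul, hA, map_add, smul_add, smul_smul]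
    _ = (θ i + W i - W (i + 1)) • (c i • E (u i)) := by
        rw [sum_add_distrib, h5, h7]; module
    _ = _ := by rw [hv1]

end SplitBasis

/-- The functions `1, t, a, a * t` are linearly dependent. -/
def BilinearlyRelated {ι F : Type*} [Field F] (a t : ι → F) : Prop :=
  ∃ x₀ x₁ x₂ x₃ : F, (x₀ ≠ 0 ∨ x₁ ≠ 0 ∨ x₂ ≠ 0 ∨ x₃ ≠ 0) ∧
    ∀ i, x₀ + x₁ * t i + x₂ * a i + x₃ * (a i * t i) = 0

/-! ### Reduction of the zero diagonal space to a dependence of scalar functions -/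

namespace LeonardSystem

variable {F V : Type*} [Field F] [AddCommGroup V] [Module F V] {d : ℕ}
  {Φ : LeonardSystem F V d} {θ θs : Fin (d + 1) → F} {φ ϕ : ℕ → F}

theorem exists_dual_eigenbasis (hθs : Φ.IsDualEigenvalueSequence θs) :
    Function.Injective θs ∧ ∃ v : Module.Basis (Fin (d + 1)) F V,
      (∀ i, Φ.As (v i) = θs i • v i) ∧
      IsIrreducibleTridiagonal (LinearMap.toMatrix v v Φ.A) ∧
      ∀ i j, Φ.Es i (v j) = if i = j then v j else 0 := by
  obtain ⟨θ', ⟨⟨hinj, -⟩, v, hv, htri⟩, hE⟩ := Φ.standard_dual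
  obtain rfl : θ' = θs := funext fun i => (hE i).eigenvalue_unique (hθs i)
  refine ⟨hinj, v, hv, htri, fun i j => ?_⟩
  have hmem : v j ∈ Φ.As.eigenspace (θ' j) := Module.End.mem_eigenspace_iff.2 (hv j)
  split_ifs with h
  · subst h
    exact (hE i).apply_self _ hmem
  · exact (hE i).apply_other _ (fun h' => h (hinj h').symm) _ hmem

theorem exists_eigenbasis (hθ : Φ.IsEigenvalueSequence θ) :
    ∃ v : Module.Basis (Fin (d + 1)) F V, ∀ i, Φ.A (v i) = θ i • v i := by
  obtain ⟨θ', ⟨-, v, hv, -⟩, hE⟩ := Φ.standard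
  obtain rfl : θ' = θ := funext fun i => (hE i).eigenvalue_unique (hθ i)
  exact ⟨v, hv⟩

theorem aeval_prod_eq_zero (hθ : Φ.IsEigenvalueSequence θ) :
    Polynomial.aeval Φ.A (∏ j, (Polynomial.X - Polynomial.C (θ j))) = 0 := by
  obtain ⟨v, hv⟩ := exists_eigenbasis hθ
  refine v.ext fun i => ?_
  rw [Module.End.aeval_apply_of_hasEigenvector
    ⟨Module.End.mem_eigenspace_iff.2 (hv i), v.ne_zero i⟩, Polynomial.eval_prod,
    prod_eq_zero (mem_univ i) (by simp)]
  simp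

/-- For i = d the product runs over all eigenvalues and annihilates A, which agrees with the zero
value of `extendFin` past the end. -/
theorem IsSplitBasis.apply (hθ : Φ.IsEigenvalueSequence θ) {u : Module.Basis (Fin (d + 1)) F V}
    (hu : Φ.IsSplitBasis u) (i : Fin (d + 1)) :
    Φ.A (u i) = θ i • u i + extendFin u (i + 1) := by
  obtain ⟨θ', hθ', x, -, -, h⟩ := hu
  obtain rfl : θ' = θ := funext fun i => (hθ' i).eigenvalue_unique (hθ i)
  have key : Φ.A (u i) - θ' i • u i = Polynomial.aeval Φ.A
      (∏ j ∈ Iic i, (Polynomial.X - Polynomial.C (θ' j))) x := by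
    rw [← Iio_insert, prod_insert (by simp), map_mul, h]
    simp [Module.algebraMap_end_apply]
  rw [add_comm (θ' i • u i), ← sub_eq_iff_eq_add, key, extendFin]
  split_ifs with hi
  · rw [h]
    have : Iic i = Iio (⟨i + 1, hi⟩ : Fin (d + 1)) := by
      ext j
      simp only [mem_Iic, mem_Iio, Fin.lt_def, Fin.le_def]
      omega
    rw [this]
  · have : Iic i = univ := by
      ext j
      simp only [mem_Iic, mem_univ, iff_true, Fin.le_def]
      omega
    rw [this, aeval_prod_eq_zero hθ, LinearMap.zero_apply]

/-- `W k` is φₖ/(θ*ₖ − θ*ₖ₋₁) for 1 ≤ k ≤ d. -/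
theorem IsParameterArray.exists_compression (h : Φ.IsParameterArray θ θs φ ϕ) :
    ∃ W : ℕ → F, W 0 = 0 ∧ W (d + 1) = 0 ∧
      (∀ (k : ℕ) (hk : k < d),
        W (k + 1) * (θs ⟨k + 1, by omega⟩ - θs ⟨k, by omega⟩) = φ (k + 1)) ∧
      ∀ i, Φ.Es i * Φ.A * Φ.Es i = (θ i + W i - W (i + 1)) • Φ.Es i := by
  obtain ⟨hinj, v, hv, -, hE⟩ := exists_dual_eigenbasis h.dualEigenvalue
  obtain ⟨θ', hθ', u, hu, hAs⟩ := h.firstSplit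
  obtain rfl : θ' = θs := funext fun i => (hθ' i).eigenvalue_unique (h.dualEigenvalue i)
  let W : ℕ → F := fun k => φ k / (extendFin θ' k - extendFin θ' (k - 1))
  -- φ₀ and φ_{d+1} are arbitrary, so the boundary values are set to 0; one formula then covers i =
  -- 0 and i = d.
  let W' : ℕ → F := fun k => if k = 0 ∨ k = d + 1 then 0 else W k
  have hW0 : W' 0 = 0 := if_pos (Or.inl rfl)
  have hWd : W' (d + 1) = 0 := if_pos (Or.inr rfl)
  have hW : ∀ (k : ℕ) (hk : k < d),
      W' (k + 1) * (θ' ⟨k + 1, by omega⟩ - θ' ⟨k, by omega⟩) = φ (k + 1) := by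
    intro k hk
    simp only [W', W]
    rw [if_neg (by omega), extendFin, dif_pos (by omega), extendFin, dif_pos (by omega)]
    refine div_mul_cancel₀ _ (sub_ne_zero.2 fun h' => ?_)
    simpa using hinj h'
  refine ⟨W', hW0, hWd, hW, fun i => v.ext fun j => ?_⟩
  simp only [Module.End.mul_apply, LinearMap.smul_apply, hE]
  split_ifs with hij
  · subst hij
    refine compress_eigenvector u hinj (hu.apply h.eigenvalue) hAs i (hv i)
      (by rw [hE, if_pos rfl]) (fun w => ?_) hW0 hWd hW
    refine LinearMap.congr_fun (f := Φ.Es i ∘ₗ Φ.As) (g := θ' i • Φ.Es i) (v.ext fun k => ?_) w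
    simp only [LinearMap.comp_apply, LinearMap.smul_apply, hv, map_smul, hE]
    split_ifs with hik
    · rw [hik]
    · simp
  · simp

theorem zeroDiagonalSpace_ne_bot_iff (hd : 1 < d) (hθs : Φ.IsDualEigenvalueSequence θs)
    {a : Fin (d + 1) → F} (ha : ∀ i, Φ.Es i * Φ.A * Φ.Es i = a i • Φ.Es i) :
    Φ.zeroDiagonalSpace ≠ ⊥ ↔ BilinearlyRelated a θs := by
  obtain ⟨hinj, v, hv, htri, hE⟩ := exists_dual_eigenbasis hθs
  have hcomp : ∀ i, Φ.Es i * Φ.Es i = Φ.Es i := by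
    intro i
    refine v.ext fun j => ?_
    rw [Module.End.mul_apply, hE]
    split_ifs with h
    · rw [hE, if_pos h]
    · simp
  have hcomm : ∀ i, Φ.As * Φ.Es i = θs i • Φ.Es i := by
    intro i
    refine v.ext fun j => ?_
    rw [Module.End.mul_apply, LinearMap.smul_apply, hE]
    split_ifs with h
    · rw [hv, h]
    · simp
  have hcomm' : ∀ i, Φ.Es i * Φ.As = θs i • Φ.Es i := by
    intro i
    refine v.ext fun j => ?_
    rw [Module.End.mul_apply, LinearMap.smul_apply, hv, map_smul, hE]
    split_ifs with h
    · rw [h]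
    · simp
  have hEne : ∀ i, Φ.Es i ≠ 0 := by
    intro i h
    have h1 := hE i i
    rw [h, if_pos rfl] at h1
    exact v.ne_zero i h1.symm
  have hsand : ∀ (x₀ x₁ x₂ x₃ : F) i,
      Φ.Es i * (x₀ • 1 + x₁ • Φ.As + x₂ • Φ.A + x₃ • (Φ.A * Φ.As)) * Φ.Es i =
        (x₀ + x₁ * θs i + x₂ * a i + x₃ * (a i * θs i)) • Φ.Es i := by
    intro x₀ x₁ x₂ x₃ i
    have h1 : Φ.Es i * (x₀ • 1 + x₁ • Φ.As + x₂ • Φ.A + x₃ • (Φ.A * Φ.As)) * Φ.Es i =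
        x₀ • (Φ.Es i * Φ.Es i) + x₁ • (Φ.Es i * (Φ.As * Φ.Es i)) + x₂ • (Φ.Es i * Φ.A * Φ.Es i) +
          x₃ • (Φ.Es i * Φ.A * (Φ.As * Φ.Es i)) := by
      simp only [mul_add, add_mul, mul_smul_comm, smul_mul_assoc, mul_one, mul_assoc]
    rw [h1, hcomm, mul_smul_comm, mul_smul_comm, ha, hcomp]
    module
  have hspan : ∀ X, X ∈ Submodule.span F {1, Φ.As, Φ.A, Φ.A * Φ.As} ↔
      ∃ x₀ x₁ x₂ x₃ : F, x₀ • 1 + x₁ • Φ.As + x₂ • Φ.A + x₃ • (Φ.A * Φ.As) = X := by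
    intro X
    simp only [Submodule.mem_span_insert, Submodule.mem_span_singleton]
    constructor
    · rintro ⟨x₀, _, ⟨x₁, _, ⟨x₂, _, ⟨x₃, rfl⟩, rfl⟩, rfl⟩, rfl⟩
      exact ⟨x₀, x₁, x₂, x₃, by abel⟩
    · rintro ⟨x₀, x₁, x₂, x₃, rfl⟩
      exact ⟨x₀, _, ⟨x₁, _, ⟨x₂, _, ⟨x₃, rfl⟩, rfl⟩, rfl⟩, by abel⟩
  rw [Submodule.ne_bot_iff]
  constructor
  · rintro ⟨X, ⟨hX, hX0⟩, hne⟩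
    obtain ⟨x₀, x₁, x₂, x₃, rfl⟩ := (hspan X).1 hX
    refine ⟨x₀, x₁, x₂, x₃, ?_, fun i => ?_⟩
    · by_contra! h
      obtain ⟨rfl, rfl, rfl, rfl⟩ := h
      simp at hne
    · have h1 := hX0 i
      rw [hsand] at h1
      exact (smul_eq_zero.1 h1).resolve_right (hEne i)
  · rintro ⟨x₀, x₁, x₂, x₃, hne, hrel⟩
    refine ⟨_, ⟨(hspan _).2 ⟨x₀, x₁, x₂, x₃, rfl⟩, fun i => ?_⟩, fun h0 => ?_⟩
    · rw [hsand, hrel, zero_smul]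
    · have happ : ∀ i, (x₀ + x₁ * θs i) • v i + (x₂ + x₃ * θs i) • Φ.A (v i) = 0 := by
        intro i
        have h1 := LinearMap.congr_fun h0 (v i)
        simp only [LinearMap.add_apply, LinearMap.smul_apply, Module.End.one_apply,
          Module.End.mul_apply, hv, map_smul, LinearMap.zero_apply] at h1
        rw [← h1]
        module
      -- The coordinate at vₖ₊₁ comes from A vₖ alone and carries a nonzero subdiagonal entry. Using
      -- it for k = 0 and k = 1 is why d > 1 is needed.
      have h2 : ∀ k (hk : k < d), x₂ + x₃ * θs ⟨k, by omega⟩ = 0 := by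
        intro k hk
        have h3 := congrArg (fun w => v.repr w ⟨k + 1, by omega⟩) (happ ⟨k, by omega⟩)
        have h4 := htri.irreducible ⟨k + 1, by omega⟩ ⟨k, by omega⟩ (Or.inr rfl)
        rw [LinearMap.toMatrix_apply] at h4
        simp at h3
        exact h3.resolve_right h4
      have h01 : θs ⟨0, by omega⟩ - θs ⟨1, by omega⟩ ≠ 0 := sub_ne_zero.2 fun h => by
        simpa using hinj h
      have h30 := h2 0 (by omega)
      have h31 := h2 1 (by omega)
      have hx3 : x₃ = 0 := (mul_eq_zero.1
        (by linear_combination h30 - h31 : x₃ * (θs ⟨0, _⟩ - θs ⟨1, _⟩) = 0)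
        ).resolve_right h01
      have hx2 : x₂ = 0 := by rw [hx3] at h30; linear_combination h30
      have h4 : ∀ i, x₀ + x₁ * θs i = 0 := by
        intro i
        have h5 := happ i
        rw [hx2, hx3, zero_mul, add_zero, zero_smul, add_zero] at h5
        exact (smul_eq_zero.1 h5).resolve_right (v.ne_zero i)
      have hx1 : x₁ = 0 := (mul_eq_zero.1
        (by linear_combination h4 ⟨0, by omega⟩ - h4 ⟨1, by omega⟩ :
          x₁ * (θs ⟨0, _⟩ - θs ⟨1, _⟩) = 0)).resolve_right h01
      have hx0 : x₀ = 0 := by have := h4 0; rw [hx1] at this; linear_combination this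
      simp [hx0, hx1, hx2, hx3] at hne

end LeonardSystem

/-! ### Dependence of 1, t, a, at when a is a rational function of t -/

section BilinearlyRelated

variable {ι F : Type*} [Field F]

/-- Translating a and changing t affinely acts invertibly on the four coefficients. -/
theorem BilinearlyRelated.affine {a t : ι → F} (h : BilinearlyRelated a t) {a' t' : ι → F}
    {b c g : F} (ha : ∀ i, a i = a' i + c) (hg : g ≠ 0) (ht : ∀ i, t i = b + g * t' i) :
    BilinearlyRelated a' t' := by
  obtain ⟨x₀, x₁, x₂, x₃, hne, h⟩ := h
  refine ⟨x₀ + x₁ * b + x₂ * c + x₃ * c * b, g * (x₁ + x₃ * c), x₂ + x₃ * b, g * x₃, ?_,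
    fun i => ?_⟩
  · by_contra! h0
    obtain ⟨h0, h1, h2, h3⟩ := h0
    have h3' : x₃ = 0 := (mul_eq_zero.1 h3).resolve_left hg
    subst h3'
    have h2' : x₂ = 0 := by linear_combination h2
    have h1' : x₁ = 0 := by simpa [hg] using h1
    subst h2' h1'
    have h0' : x₀ = 0 := by linear_combination h0
    simp [h0'] at hne
  · have h1 := h i
    rw [ha, ht] at h1
    linear_combination h1

theorem bilinearlyRelated_affine_iff {a t a' t' : ι → F} {b c g : F}
    (ha : ∀ i, a i = a' i + c) (hg : g ≠ 0) (ht : ∀ i, t i = b + g * t' i) :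
    BilinearlyRelated a t ↔ BilinearlyRelated a' t' :=
  ⟨fun h => h.affine ha hg ht, fun h => h.affine (b := -b / g) (c := -c) (g := g⁻¹)
    (fun i => by rw [ha]; ring) (inv_ne_zero hg) fun i => by rw [ht]; field_simp; ring⟩

/-- A nonzero cubic has at most three roots, while t takes d + 1 ≥ 4 values. -/
theorem cubic_coeff_eq_zero {d : ℕ} (hd : 3 ≤ d) {t : Fin (d + 1) → F}
    (ht : Function.Injective t) {c₀ c₁ c₂ c₃ : F}
    (h : ∀ i, c₀ + c₁ * t i + c₂ * t i ^ 2 + c₃ * t i ^ 3 = 0) :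
    c₀ = 0 ∧ c₁ = 0 ∧ c₂ = 0 ∧ c₃ = 0 := by
  let p : Polynomial F := Polynomial.C c₀ + Polynomial.C c₁ * Polynomial.X +
    Polynomial.C c₂ * Polynomial.X ^ 2 + Polynomial.C c₃ * Polynomial.X ^ 3
  have hp : p = 0 := by
    refine Polynomial.eq_zero_of_natDegree_lt_card_of_eval_eq_zero p ht (fun i => ?_) ?_
    · simpa [p] using h i
    · have : p.natDegree ≤ 3 := by unfold p; compute_degree
      simp only [Fintype.card_fin]
      omega
  refine ⟨?_, ?_, ?_, ?_⟩
  · simpa [p, Polynomial.coeff_X, Polynomial.coeff_C] using congrArg (Polynomial.coeff · 0) hp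
  · simpa [p, Polynomial.coeff_X, Polynomial.coeff_C] using congrArg (Polynomial.coeff · 1) hp
  · simpa [p, Polynomial.coeff_X, Polynomial.coeff_C] using congrArg (Polynomial.coeff · 2) hp
  · simpa [p, Polynomial.coeff_X, Polynomial.coeff_C] using congrArg (Polynomial.coeff · 3) hp

/-- If `a` is a rational function of `t` with denominator `t ^ 2 - κ ^ 2`, except perhaps at the
poles, then `1, t, a, a * t` are linearly independent unless one of the poles is removable. -/
theorem not_bilinearlyRelated_of_two_poles {d : ℕ} (hd : 3 ≤ d) {a t : Fin (d + 1) → F}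
    (ht : Function.Injective t) {κ m ρ : F}
    (h : ∀ i, a i * (t i ^ 2 - κ ^ 2) = m * t i + ρ)
    (h₁ : m * κ + ρ ≠ 0 ∨ ∃ e, t e = κ ∧ a e * (2 * κ) ≠ m)
    (h₂ : m * -κ + ρ ≠ 0 ∨ ∃ e, t e = -κ ∧ a e * (2 * -κ) ≠ m) :
    ¬ BilinearlyRelated a t := by
  rintro ⟨x₀, x₁, x₂, x₃, hne, hx⟩
  obtain ⟨c0, c1, c2, c3⟩ := cubic_coeff_eq_zero hd ht
    (c₀ := -x₀ * κ ^ 2 + ρ * x₂) (c₁ := -x₁ * κ ^ 2 + m * x₂ + ρ * x₃)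
    (c₂ := x₀ + m * x₃) (c₃ := x₁) fun i => by
      linear_combination (t i ^ 2 - κ ^ 2) * hx i - (x₂ + x₃ * t i) * h i
  subst c3
  have hx0 : x₀ = -(m * x₃) := by linear_combination c2
  subst hx0
  have hc1 : m * x₂ + ρ * x₃ = 0 := by linear_combination c1
  have hc0 : ρ * x₂ + κ ^ 2 * m * x₃ = 0 := by linear_combination c0
  have fin : ¬ (x₂ = 0 ∧ x₃ = 0) := by rintro ⟨rfl, rfl⟩; simp at hne
  -- The remaining equations `hc0`, `hc1` are linear in x₂, x₃ and have this product, up to sign, as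
  -- determinant: the numerator evaluated at both poles.
  by_cases hdet : (m * κ + ρ) * (m * -κ + ρ) = 0
  swap
  · apply fin
    constructor
    · refine (mul_eq_zero.1 (?_ : ((m * κ + ρ) * (m * -κ + ρ)) * x₂ = 0)).resolve_left hdet
      linear_combination ρ * hc0 - κ ^ 2 * m * hc1
    · refine (mul_eq_zero.1 (?_ : ((m * κ + ρ) * (m * -κ + ρ)) * x₃ = 0)).resolve_left hdet
      linear_combination ρ * hc1 - m * hc0
  -- If the numerator vanishes at κ' and m ≠ 0, the dependence is a multiple of a(t + κ') = m, which
  -- fails at `e`.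
  have key : ∀ κ' : F, m * κ' + ρ = 0 → (∃ e, t e = κ' ∧ a e * (2 * κ') ≠ m) → m = 0 := by
    rintro κ' hρ ⟨e, hte, hae⟩
    by_contra hm
    have hx2 : x₂ = κ' * x₃ := mul_left_cancel₀ hm (by linear_combination hc1 - x₃ * hρ)
    have he := hx e
    rw [hte, hx2] at he
    have hx3 : x₃ = 0 := by
      refine (mul_eq_zero.1 (?_ : (a e * (2 * κ') - m) * x₃ = 0)).resolve_left (sub_ne_zero.2 hae)
      linear_combination he
    exact fin ⟨by rw [hx2, hx3, mul_zero], hx3⟩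
  have hm : m = 0 := by
    rcases mul_eq_zero.1 hdet with h0 | h0
    · exact key κ h0 (h₁.resolve_left (not_not.2 h0))
    · exact key (-κ) h0 (h₂.resolve_left (not_not.2 h0))
  subst hm
  have hρ : ρ = 0 := by
    rcases mul_eq_zero.1 hdet with h0 | h0 <;> linear_combination h0
  subst hρ
  obtain ⟨e, hte, hae⟩ := h₁.resolve_left (by simp)
  obtain ⟨e', hte', hae'⟩ := h₂.resolve_left (by simp)
  have he := hx e
  have he' := hx e'
  rw [hte] at he
  rw [hte'] at he'
  have e1 : x₂ + x₃ * κ = 0 := (mul_eq_zero.1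
    (by linear_combination he : a e * (x₂ + x₃ * κ) = 0)).resolve_left (left_ne_zero_of_mul hae)
  have e2 : x₂ - x₃ * κ = 0 := (mul_eq_zero.1
    (by linear_combination he' : a e' * (x₂ - x₃ * κ) = 0)).resolve_left (left_ne_zero_of_mul hae')
  have hx3 : x₃ = 0 := (mul_eq_zero.1
    (by linear_combination e1 - e2 : (2 * κ) * x₃ = 0)).resolve_left (right_ne_zero_of_mul hae)
  exact fin ⟨by rw [hx3] at e1; linear_combination e1, hx3⟩

/-- If `a - α * t` is a rational function of `t` with denominator `4 * t - κ`, except perhaps at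
the pole, then `1, t, a, a * t` are linearly independent unless the pole is removable. -/
theorem not_bilinearlyRelated_of_one_pole {d : ℕ} (hd : 3 ≤ d) {a t : Fin (d + 1) → F}
    (ht : Function.Injective t) {κ α ρ : F} (h4 : (4 : F) ≠ 0) (hα : α ≠ 0)
    (h : ∀ i, (a i - α * t i) * (4 * t i - κ) = ρ)
    (hρ : ρ ≠ 0 ∨ ∃ e, a e ≠ α * t e) :
    ¬ BilinearlyRelated a t := by
  rintro ⟨x₀, x₁, x₂, x₃, hne, hx⟩
  obtain ⟨c0, c1, c2, c3⟩ := cubic_coeff_eq_zero hd ht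
    (c₀ := -x₀ * κ + ρ * x₂) (c₁ := 4 * x₀ - κ * x₁ + x₂ * (-(α * κ)) + ρ * x₃)
    (c₂ := 4 * x₁ + 4 * α * x₂ - α * κ * x₃) (c₃ := 4 * α * x₃) fun i => by
      linear_combination (4 * t i - κ) * hx i - (x₂ + x₃ * t i) * h i
  obtain rfl : x₃ = 0 := by simpa [h4, hα] using c3
  obtain rfl : x₁ = -(α * x₂) := mul_left_cancel₀ h4 (by linear_combination c2)
  obtain rfl : x₀ = 0 := mul_left_cancel₀ h4 (by linear_combination c1)
  have hx2 : x₂ = 0 := by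
    rcases hρ with hρ | ⟨e, he⟩
    · exact (mul_eq_zero.1 (by linear_combination c0 : ρ * x₂ = 0)).resolve_left hρ
    · exact (mul_eq_zero.1 (by linear_combination hx e : (a e - α * t e) * x₂ = 0)).resolve_left
        (sub_ne_zero.2 he)
  subst hx2
  simp at hne

end BilinearlyRelated

/-! ### The q-Racah computation -/

section QRacah

variable {F : Type*} [Field F]

/-- With y = qⁱ and κ² = ss(1 + q)², one has y²(t² − κ²) = (1 − ss·y²)(1 − ss·q²y²), the product of
the denominators of Wᵢ and Wᵢ₊₁. -/
theorem bilinearlyRelated_qRacah_iff [IsAlgClosed F] {d : ℕ} (hd : 3 ≤ d)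
    {a t : Fin (d + 1) → F} (ht : Function.Injective t) {q h s ss r₁ r₂ : F}
    (hq : q ≠ 0) (hh : h ≠ 0) (hss : ss ≠ 0) (hrel : r₁ * r₂ = s * ss * q ^ (d + 1))
    (hq2 : q ^ 2 ≠ 1) (hssd : ss * q ^ (d + 1) ≠ 1) {W : ℕ → F} (hW0 : W 0 = 0)
    (hWd : W (d + 1) = 0)
    (htf : ∀ i, t i * q ^ (i : ℕ) = 1 + ss * q * (q ^ (i : ℕ)) ^ 2)
    (haf : ∀ i, (a i - W i + W (i + 1)) * q ^ (i : ℕ) = h * (1 + s * q * (q ^ (i : ℕ)) ^ 2))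
    (hne : ∀ k, 1 ≤ k → k ≤ d → 1 - ss * (q ^ k) ^ 2 ≠ 0)
    (hW : ∀ k, k ≤ d + 1 → W k * (1 - ss * (q ^ k) ^ 2) * q ^ k * (1 - q) =
      h * q * ((1 - q ^ k) * (1 - (q ^ (d + 1))⁻¹ * q ^ k) * (1 - r₁ * q ^ k) *
        (1 - r₂ * q ^ k))) :
    BilinearlyRelated a t ↔ ss = r₁ ^ 2 ∨ ss = r₂ ^ 2 := by
  have hy0 : ∀ k, q ^ k ≠ 0 := fun k => pow_ne_zero k hq
  have hq1 : 1 - q ≠ 0 := by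
    intro h0; apply hq2; rw [← sub_eq_zero.1 h0, one_pow]
  have hq1' : 1 + q ≠ 0 := by
    intro h0; apply hq2; linear_combination (q - 1) * h0
  obtain ⟨ε, hε⟩ : ∃ ε, ε = (q ^ (d + 1))⁻¹ := ⟨_, rfl⟩
  have hε0 : ε ≠ 0 := by rw [hε]; exact inv_ne_zero (hy0 _)
  have hεq : ε * q ^ (d + 1) = 1 := by rw [hε]; exact inv_mul_cancel₀ (hy0 _)
  have hε1 : ss ≠ ε := by
    rintro rfl; exact hssd hεq
  rw [← hε] at hW
  have hrel' : r₁ * r₂ * ε = s * ss := by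
    linear_combination ε * hrel + s * ss * hεq
  -- This is e₂ + s + ss, with eⱼ the elementary symmetric polynomials of 1, ε, r₁, r₂. Below, ρ =
  -- −(1 + q)(ss·e₁ + e₃), and `hrel'` says e₄ = s·ss.
  obtain ⟨m, hm⟩ : ∃ m, m = ε + (1 + ε) * (r₁ + r₂) + r₁ * r₂ + s + ss := ⟨_, rfl⟩
  constructor
  · intro hrelated
    by_contra! hcon
    -- The poles are ±σ(1 + q), hence the need for a square root of ss.
    obtain ⟨σ, hσ⟩ := IsAlgClosed.exists_pow_nat_eq ss (n := 2) (by norm_num)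
    obtain ⟨ρ, hρ⟩ : ∃ ρ, ρ = -(1 + q) * (ss * (1 + ε + r₁ + r₂) +
      (ε * (r₁ + r₂) + (1 + ε) * (r₁ * r₂))) := ⟨_, rfl⟩
    have hP : ∀ i, a i * (t i ^ 2 - (σ * (1 + q)) ^ 2) = (h * q * m) * t i + h * q * ρ := by
      intro i
      have h1 := hW i (by omega)
      have h2 := hW (i + 1) (by omega)
      have h3 := htf i
      have h4 := haf i
      have hy := hy0 i
      rw [pow_succ q (i : ℕ)] at h2
      generalize q ^ (i : ℕ) = y at *
      apply mul_left_cancel₀ (mul_ne_zero (mul_ne_zero hq (pow_ne_zero 3 hy)) hq1)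
      rw [mul_pow, hσ, hρ, hm]
      linear_combination q * y * (1 - q) * a i * (t i * y + 1 + ss * q * y ^ 2) * h3
        + q * (1 - q) * (1 - ss * y ^ 2) * (1 - ss * q ^ 2 * y ^ 2) * h4
        + q * (1 - ss * q ^ 2 * y ^ 2) * h1 - (1 - ss * y ^ 2) * h2
        - h * q ^ 2 * y ^ 2 * (1 - q) * m * h3
        + (h * q ^ 2 * (1 - ss * q ^ 2 * y ^ 2) * y ^ 4 - h * q ^ 5 * (1 - ss * y ^ 2) * y ^ 4)
          * hrel'
        + h * q ^ 2 * y ^ 2 * (1 - q) * (t i * y - (1 + ss * q * y ^ 2)) * hm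
    -- Proved for an arbitrary square root, so that it also applies to −σ. The numerator at σ(1 +
    -- q), times σ, is hq(1 + q)(σ − 1)(σ − ε)(σ − r₁)(σ − r₂).
    have hpole : ∀ σ : F, σ ^ 2 = ss → h * q * m * (σ * (1 + q)) + h * q * ρ ≠ 0 ∨
        ∃ e, t e = σ * (1 + q) ∧ a e * (2 * (σ * (1 + q))) ≠ h * q * m := by
      intro σ hσ
      have hr1 : σ - r₁ ≠ 0 := sub_ne_zero.2 fun h => hcon.1 (by rw [← hσ, h])
      have hr2 : σ - r₂ ≠ 0 := sub_ne_zero.2 fun h => hcon.2 (by rw [← hσ, h])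
      -- Here the pole is t₀. The value a₀ computed from W₀ = 0 misses the continued value by a
      -- nonzero multiple of (1 − ε)(1 − r₁)(1 − r₂).
      by_cases h1 : σ = 1
      · right
        subst h1
        obtain rfl : ss = 1 := by rw [← hσ, one_pow]
        obtain rfl : s = r₁ * r₂ * ε := by linear_combination -hrel'
        refine ⟨0, ?_, fun h0 => ?_⟩
        · have := htf 0
          simp only [Fin.val_zero, pow_zero] at this
          linear_combination this
        · have h1 := haf 0
          have h2 := hW 1 (by omega)
          simp only [Fin.val_zero, pow_zero, hW0, zero_add] at h1
          rw [pow_one] at h2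
          have h3 : (1 + q) * (1 - q) * h * q ^ 2 * (1 - ε) * (1 - r₁) * (1 - r₂) = 0 := by
            linear_combination (-q * (1 - q) ^ 2) * h0 + 2 * (1 + q) * q * (1 - q) ^ 2 * h1
              - 2 * h2 - h * q ^ 2 * (1 - q) ^ 2 * hm
          exact mul_ne_zero (mul_ne_zero (mul_ne_zero (mul_ne_zero (mul_ne_zero (mul_ne_zero hq1'
            hq1) hh) (pow_ne_zero 2 hq)) (sub_ne_zero.2 hε1)) hr1) hr2 h3
      -- Here the pole is t_d, and W_{d+1} = 0 plays the same role.
      by_cases h2 : σ = ε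
      · right
        subst h2
        obtain rfl : ss = σ ^ 2 := hσ.symm
        have hs : r₁ * r₂ = s * σ := mul_right_cancel₀ hε0 (by linear_combination hrel')
        refine ⟨Fin.last d, ?_, fun h0 => ?_⟩
        all_goals have hy : q ^ d * (q * σ) = 1 := by rw [← hεq]; ring
        all_goals have hyd := hy0 d
        · have h3 := htf (Fin.last d)
          simp only [Fin.val_last] at h3
          apply mul_right_cancel₀ hyd
          linear_combination h3 + (σ * q ^ d - 1) * hy
        · have h3 := haf (Fin.last d)
          have h4 := hW d (by omega)
          simp only [Fin.val_last, hWd, add_zero] at h3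
          generalize q ^ d = y at *
          have h5 : y = (q * σ)⁻¹ := eq_inv_of_mul_eq_one_left hy
          subst h5
          have h6 : W d * (q ^ 2 - 1) * σ ^ 2 =
              -h * (q * σ - 1) * (q * σ - r₁) * (q * σ - r₂) := by
            field_simp at h4
            apply mul_left_cancel₀ hq1
            linear_combination h4
          field_simp at h3
          have h8 : h * q * (1 + q) * (σ - 1) * (σ - r₁) * (σ - r₂) = 0 := by
            linear_combination -(q - 1) * σ * h0 + 2 * (q ^ 2 - 1) * σ * h3 + 2 * h6
              - h * q * (q - 1) * σ * hm + h * (2 - q - q ^ 2) * hs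
          exact mul_ne_zero (mul_ne_zero (mul_ne_zero (mul_ne_zero (mul_ne_zero hh hq) hq1')
            (sub_ne_zero.2 h1)) hr1) hr2 h8
      · left
        intro h0
        have h3 : h * q * (1 + q) * ((σ - 1) * (σ - ε) * (σ - r₁) * (σ - r₂)) = 0 := by
          rw [hm, hρ, ← hσ] at h0
          linear_combination σ * h0 + h * q * (1 + q) * hrel' - h * q * (1 + q) * s * hσ
        exact mul_ne_zero (mul_ne_zero (mul_ne_zero hh hq) hq1') (mul_ne_zero (mul_ne_zero
          (mul_ne_zero (sub_ne_zero.2 h1) (sub_ne_zero.2 h2)) hr1) hr2) h3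
    have hpole' := hpole (-σ) (by rw [neg_sq, hσ])
    rw [neg_mul] at hpole'
    exact not_bilinearlyRelated_of_two_poles hd ht hP (hpole σ hσ) hpole' hrelated
  · have key : ∀ r₁ r₂, ss = r₁ ^ 2 → r₁ * r₂ * ε = s * ss →
        m = ε + (1 + ε) * (r₁ + r₂) + r₁ * r₂ + s + ss →
        (∀ k, k ≤ d + 1 → W k * (1 - ss * (q ^ k) ^ 2) * q ^ k * (1 - q) =
          h * q * ((1 - q ^ k) * (1 - ε * q ^ k) * (1 - r₁ * q ^ k) * (1 - r₂ * q ^ k))) →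
        BilinearlyRelated a t := by
      clear hrel hrel' hm hW
      intro r₁ r₂ hr hrel hm hW
      subst hr
      have hr0 : r₁ ≠ 0 := fun h0 => hss (by rw [h0]; ring)
      have hrel' : r₂ * ε = s * r₁ := mul_left_cancel₀ hr0 (by linear_combination hrel)
      have hW' : ∀ k, k ≤ d + 1 → W k * (1 + r₁ * q ^ k) * q ^ k * (1 - q) =
          h * q * ((1 - q ^ k) * (1 - ε * q ^ k) * (1 - r₂ * q ^ k)) := by
        intro k hk
        rcases Nat.eq_zero_or_pos k with rfl | hk0
        · rw [hW0]; ring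
        rcases Nat.eq_or_lt_of_le hk with rfl | hk1
        · rw [hWd, hεq]; ring
        have h1 := hne k hk0 (by omega)
        have h2 : 1 - r₁ * q ^ k ≠ 0 := by
          intro h3; apply h1; linear_combination (1 + r₁ * q ^ k) * h3
        apply mul_left_cancel₀ h2
        linear_combination hW k hk
      -- With the pole at t = r₁(1 + q) removed, what remains is a(t + r₁(1 + q)) = hqm.
      refine ⟨-(h * q * m), 0, r₁ * (1 + q), 1, by simp, fun i => ?_⟩
      have h1 := hW' i (by omega)
      have h2 := hW' (i + 1) (by omega)
      have h3 := htf i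
      have h4 := haf i
      have hy := hy0 i
      rw [pow_succ q (i : ℕ)] at h2
      generalize q ^ (i : ℕ) = y at *
      apply mul_left_cancel₀ (mul_ne_zero (mul_ne_zero hq (pow_ne_zero 2 hy)) hq1)
      linear_combination q * (1 - q) * y * a i * h3
        + q * (1 - q) * (1 + r₁ * y) * (1 + r₁ * q * y) * h4
        + q * (1 + r₁ * q * y) * h1 - (1 + r₁ * y) * h2 - h * q ^ 2 * (1 - q) * y ^ 2 * hm
        - (h * q ^ 2 * y ^ 3 * (1 - q ^ 2) + h * q ^ 3 * y ^ 4 * r₁ * (1 - q)) * hrel'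
    rintro (hr | hr)
    · exact key r₁ r₂ hr hrel' hm hW
    · refine key r₂ r₁ hr (by rw [mul_comm r₂, hrel']) (by rw [hm]; ring) fun k hk => ?_
      rw [hW k hk]; ring

end QRacah

/-! ### The Racah computation -/

section Racah

variable {F : Type*} [Field F]

/-- At x = i, 4t + ss(ss + 2) = (2x + ss)(2x + ss + 2) is the product of the two denominators, so a
is affine in t plus a single fraction. A dependence exists only if a is exactly affine in t. -/
theorem bilinearlyRelated_racah_iff {d : ℕ} (hd : 3 ≤ d) {a t : Fin (d + 1) → F}
    (ht : Function.Injective t) {h s ss r₁ r₂ θ₀ : F} (hh : h ≠ 0) (h2 : (2 : F) ≠ 0)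
    (hrel : r₁ + r₂ = s + ss + d + 1) (hd₁ : (ss = 0 ∨ ss = -2 * (d + 1)) → (d : F) + 1 ≠ 0)
    {W : ℕ → F} (hW0 : W 0 = 0) (hWd : W (d + 1) = 0)
    (htf : ∀ i : Fin (d + 1), t i = ((i : ℕ) : F) * ((i : ℕ) + 1 + ss))
    (haf : ∀ i : Fin (d + 1), a i - W i + W (i + 1) = θ₀ + h * (i : ℕ) * ((i : ℕ) + 1 + s))
    (hne : ∀ k : ℕ, 1 ≤ k → k ≤ d → 2 * (k : F) + ss ≠ 0)
    (hW : ∀ k : ℕ, k ≤ d + 1 →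
      W k * (2 * k + ss) = h * k * (k - d - 1) * (k + r₁) * (k + r₂)) :
    BilinearlyRelated a t ↔ ss = 2 * r₁ ∨ ss = 2 * r₂ := by
  have h4 : (4 : F) ≠ 0 := by
    have := mul_ne_zero h2 h2; norm_num at this; exact this
  have h8 : (8 : F) ≠ 0 := by
    have := mul_ne_zero h2 h4; norm_num at this; exact this
  obtain rfl : s = r₁ + r₂ - ss - d - 1 := by linear_combination -hrel
  -- The constants c, α, ρ are those of the expansion a = c + αt + ρ/(4t + ss(ss + 2)).
  obtain ⟨c, hc⟩ : ∃ c, 8 * c = 8 * θ₀ - h * (4 + (4 * (r₁ + r₂ - ss - d - 1) + 2 * ss) +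
      4 * (-(d + 1) * (r₁ + r₂) + r₁ * r₂) - ss * (2 * (r₁ + r₂ - ss - d - 1) + ss)) :=
    ⟨_ / 8, mul_div_cancel₀ _ h8⟩
  obtain ⟨α, hα⟩ : ∃ α, 2 * α = -h := ⟨_ / 2, mul_div_cancel₀ _ h2⟩
  have hα0 : α ≠ 0 := by
    rintro rfl; apply hh; linear_combination hα
  obtain ⟨ρ, hρ⟩ : ∃ ρ, 8 * ρ = h * ss * (ss + 2 * (d + 1)) * (ss - 2 * r₁) * (ss - 2 * r₂) :=
    ⟨_ / 8, mul_div_cancel₀ _ h8⟩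
  constructor
  · intro hrelated
    by_contra! hcon
    have hr1 := sub_ne_zero.2 hcon.1
    have hr2 := sub_ne_zero.2 hcon.2
    have hrelated' : BilinearlyRelated (fun i => a i - c) t :=
      hrelated.affine (b := 0) (c := c) (g := 1) (fun i => by ring) one_ne_zero
        fun i => by ring
    refine not_bilinearlyRelated_of_one_pole hd ht (κ := -(ss * (ss + 2))) h4 hα0 (ρ := ρ)
      (fun i => ?_) ?_ hrelated'
    · have e1 := hW i (by omega)
      have e2 := hW (i + 1) (by omega)
      have e3 := haf i
      rw [htf]
      push_cast at e2
      apply mul_left_cancel₀ h8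
      generalize ((i : ℕ) : F) = x at *
      linear_combination 8 * (2 * x + ss + 2) * e1 - 8 * (2 * x + ss) * e2
        + 8 * (2 * x + ss) * (2 * x + ss + 2) * e3 - (2 * x + ss) * (2 * x + ss + 2) * hc - hρ
        - 4 * x * (x + 1 + ss) * (2 * x + ss) * (2 * x + ss + 2) * hα
    · by_cases hρ0 : ρ = 0
      swap
      · exact Or.inl hρ0
      right
      have e1 : ss * (ss + 2 * (d + 1)) = 0 := by
        rw [hρ0, mul_zero] at hρ
        simpa [hh, hr1, hr2] using hρ.symm
      -- These are the cases where the pole is t₀ or t_d. The defect of a there is a nonzero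
      -- multiple of (d + 1)(ss − 2r₁)(ss − 2r₂).
      rcases mul_eq_zero.1 e1 with rfl | e2
      · refine ⟨0, fun e => ?_⟩
        have e3 := hW 1 (by omega)
        have e4 := haf 0
        rw [htf] at e
        simp only [Fin.val_zero, Nat.cast_zero, zero_add, hW0] at e e4
        push_cast at e3
        refine mul_ne_zero (mul_ne_zero (mul_ne_zero hh (hd₁ (Or.inl rfl))) hr1) hr2 ?_
        linear_combination 8 * e - 8 * e4 + 4 * e3 + hc
      · obtain rfl : ss = -2 * (d + 1) := by linear_combination e2
        refine ⟨Fin.last d, fun e => ?_⟩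
        have e3 := hW d (by omega)
        have e4 := haf (Fin.last d)
        rw [htf] at e
        simp only [Fin.val_last, hWd] at e e4
        refine mul_ne_zero (mul_ne_zero (mul_ne_zero hh (hd₁ (Or.inr rfl))) hr1) hr2 ?_
        linear_combination 8 * e - 8 * e4 + 4 * e3 + hc + 4 * d * (d + 1 + -2 * (d + 1)) * hα
  · have key : ∀ r₁' r₂', ss = 2 * r₁' → r₁ + r₂ = r₁' + r₂' → r₁ * r₂ = r₁' * r₂' →
        BilinearlyRelated a t := by
      intro r₁' r₂' hr hadd hmul
      have hW' : ∀ k : ℕ, k ≤ d + 1 → 2 * W k = h * k * (k - d - 1) * (k + r₂') := by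
        intro k hk
        rcases Nat.eq_zero_or_pos k with rfl | hk0
        · rw [hW0]; push_cast; ring
        rcases Nat.eq_or_lt_of_le hk with rfl | hk1
        · rw [hWd]; push_cast; ring
        apply mul_left_cancel₀ (hne k hk0 (by omega))
        linear_combination 2 * hW k hk + 2 * h * k * (k - d - 1) * (k * hadd + hmul)
          - h * k * (k - d - 1) * (k + r₂') * hr
      refine ⟨-c, -α, 1, 0, by simp, fun i => ?_⟩
      have e1 := hW' i (by omega)
      have e2 := hW' (i + 1) (by omega)
      have e3 := haf i
      rw [htf]
      push_cast at e2
      apply mul_left_cancel₀ h8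
      generalize ((i : ℕ) : F) = x at *
      rw [hadd] at e3
      rw [hadd, hmul] at hc
      subst hr
      linear_combination 4 * e1 - 4 * e2 + 8 * e3 - hc - 4 * x * (x + 1 + 2 * r₁') * hα
    rintro (hr | hr)
    · exact key r₁ r₂ hr rfl rfl
    · exact key r₂ r₁ hr (add_comm _ _) (mul_comm _ _)

end Racah

/-! ### The Bannai/Ito computation -/

section BannaiIto

variable {F : Type*} [Field F] {d : ℕ} {a t : Fin (d + 1) → F}
  {h s ss θ₀ A₁ A₂ B₁ B₂ m ρ : F} {W : ℕ → F}

/-- At x = i, t² − 1 = (2x − ss)(2x + 2 − ss) for either parity of i, so the poles are ±1. The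
numerator is −h(ss + 2A₁)(ss + 2A₂) at 1 and h(ss + 2B₁)(ss + 2B₂) at −1. The parameters A (even k)
and B (odd k) let one computation serve both parities of d. -/
theorem bannaiIto_partial_fractions (h2 : (2 : F) ≠ 0) (hsum : A₁ + A₂ + B₁ + B₂ = -s - ss)
    (htf : ∀ i : Fin (d + 1), t i = (1 - ss + 2 * ((i : ℕ) : F)) * (-1) ^ (i : ℕ))
    (haf : ∀ i : Fin (d + 1), a i - W i + W (i + 1) =
      θ₀ + h * (s - 1 + (1 - s + 2 * ((i : ℕ) : F)) * (-1) ^ (i : ℕ)))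
    (hWe : ∀ k : ℕ, k ≤ d + 1 → Even k → W k * (2 * k - ss) = -2 * h * (k + A₁) * (k + A₂))
    (hWo : ∀ k : ℕ, k ≤ d + 1 → Odd k → W k * (2 * k - ss) = 2 * h * (k + B₁) * (k + B₂))
    (hm : 2 * m = -h * ((ss + 2 * A₁) * (ss + 2 * A₂) + (ss + 2 * B₁) * (ss + 2 * B₂)))
    (hρ : 2 * ρ = -h * ((ss + 2 * A₁) * (ss + 2 * A₂) - (ss + 2 * B₁) * (ss + 2 * B₂)))
    (i : Fin (d + 1)) :
    (a i - (θ₀ - h + h * s)) * (t i ^ 2 - 1 ^ 2) = m * t i + ρ := by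
  obtain rfl : s = -ss - A₁ - A₂ - B₁ - B₂ := by linear_combination hsum
  have e3 := haf i
  have e4 := htf i
  apply mul_left_cancel₀ h2
  rcases Nat.even_or_odd (i : ℕ) with hi | hi
  · have e1 := hWe i (by omega) hi
    have e2 := hWo (i + 1) (by omega) hi.add_one
    rw [hi.neg_one_pow] at e3 e4
    rw [e4]
    push_cast at e2
    generalize ((i : ℕ) : F) = x at *
    linear_combination 2 * (2 * x - ss) * (2 * x + 2 - ss) * e3 + 2 * (2 * x + 2 - ss) * e1
      - 2 * (2 * x - ss) * e2 - (1 - ss + 2 * x) * hm - hρ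
  · have e1 := hWo i (by omega) hi
    have e2 := hWe (i + 1) (by omega) hi.add_one
    rw [hi.neg_one_pow] at e3 e4
    rw [e4]
    push_cast at e2
    generalize ((i : ℕ) : F) = x at *
    linear_combination 2 * (2 * x - ss) * (2 * x + 2 - ss) * e3 + 2 * (2 * x + 2 - ss) * e1
      - 2 * (2 * x - ss) * e2 + (1 - ss + 2 * x) * hm - hρ

/-- When ss = −2A₁, a factor cancels from W at even k and the pole t = 1 disappears, leaving (a −
c)(t + 1) = m. -/
theorem bilinearlyRelated_of_even_linear (h2 : (2 : F) ≠ 0)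
    (hsum : A₁ + A₂ + B₁ + B₂ = -s - ss) (hA : ss = -2 * A₁)
    (htf : ∀ i : Fin (d + 1), t i = (1 - ss + 2 * ((i : ℕ) : F)) * (-1) ^ (i : ℕ))
    (haf : ∀ i : Fin (d + 1), a i - W i + W (i + 1) =
      θ₀ + h * (s - 1 + (1 - s + 2 * ((i : ℕ) : F)) * (-1) ^ (i : ℕ)))
    (hWe : ∀ k : ℕ, k ≤ d + 1 → Even k → W k = -h * (k + A₂))
    (hWo : ∀ k : ℕ, k ≤ d + 1 → Odd k → W k * (2 * k - ss) = 2 * h * (k + B₁) * (k + B₂)) :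
    BilinearlyRelated a t := by
  obtain ⟨m, hm⟩ : ∃ m, 2 * m = -h * ((ss + 2 * B₁) * (ss + 2 * B₂)) :=
    ⟨_ / 2, mul_div_cancel₀ _ h2⟩
  obtain rfl : s = -ss - A₁ - A₂ - B₁ - B₂ := by linear_combination hsum
  obtain ⟨c, hc⟩ : ∃ c, c = θ₀ - h + h * (-ss - A₁ - A₂ - B₁ - B₂) := ⟨_, rfl⟩
  refine ⟨-c - m, -c, 1, 1, by simp, fun i => ?_⟩
  have e3 := haf i
  have e4 := htf i
  apply mul_left_cancel₀ h2
  rcases Nat.even_or_odd (i : ℕ) with hi | hi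
  · have e1 := hWe i (by omega) hi
    have e2 := hWo (i + 1) (by omega) hi.add_one
    rw [hi.neg_one_pow] at e3 e4
    rw [e4]
    push_cast at e2
    generalize ((i : ℕ) : F) = x at *
    subst hA
    linear_combination 2 * (2 * x + 2 + 2 * A₁) * e3 + 2 * (2 * x + 2 + 2 * A₁) * e1
      - 2 * e2 - hm - 2 * (2 * x + 2 + 2 * A₁) * hc
  · have e1 := hWo i (by omega) hi
    have e2 := hWe (i + 1) (by omega) hi.add_one
    rw [hi.neg_one_pow] at e3 e4
    rw [e4]
    push_cast at e2
    generalize ((i : ℕ) : F) = x at *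
    subst hA
    linear_combination -2 * (2 * x + 2 * A₁) * e3 - 2 * e1 + 2 * (2 * x + 2 * A₁) * e2
      - hm + 2 * (2 * x + 2 * A₁) * hc

/-- The mirror case: the pole t = −1 disappears, leaving (a − c)(t − 1) = m. -/
theorem bilinearlyRelated_of_odd_linear (h2 : (2 : F) ≠ 0)
    (hsum : A₁ + A₂ + B₁ + B₂ = -s - ss) (hB : ss = -2 * B₁)
    (htf : ∀ i : Fin (d + 1), t i = (1 - ss + 2 * ((i : ℕ) : F)) * (-1) ^ (i : ℕ))
    (haf : ∀ i : Fin (d + 1), a i - W i + W (i + 1) =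
      θ₀ + h * (s - 1 + (1 - s + 2 * ((i : ℕ) : F)) * (-1) ^ (i : ℕ)))
    (hWe : ∀ k : ℕ, k ≤ d + 1 → Even k → W k * (2 * k - ss) = -2 * h * (k + A₁) * (k + A₂))
    (hWo : ∀ k : ℕ, k ≤ d + 1 → Odd k → W k = h * (k + B₂)) :
    BilinearlyRelated a t := by
  obtain ⟨m, hm⟩ : ∃ m, 2 * m = -h * ((ss + 2 * A₁) * (ss + 2 * A₂)) :=
    ⟨_ / 2, mul_div_cancel₀ _ h2⟩
  obtain rfl : s = -ss - A₁ - A₂ - B₁ - B₂ := by linear_combination hsum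
  obtain ⟨c, hc⟩ : ∃ c, c = θ₀ - h + h * (-ss - A₁ - A₂ - B₁ - B₂) := ⟨_, rfl⟩
  refine ⟨c - m, -c, -1, 1, by simp, fun i => ?_⟩
  have e3 := haf i
  have e4 := htf i
  apply mul_left_cancel₀ h2
  rcases Nat.even_or_odd (i : ℕ) with hi | hi
  · have e1 := hWe i (by omega) hi
    have e2 := hWo (i + 1) (by omega) hi.add_one
    rw [hi.neg_one_pow] at e3 e4
    rw [e4]
    push_cast at e2
    generalize ((i : ℕ) : F) = x at *
    subst hB
    linear_combination 2 * (2 * x + 2 * B₁) * e3 + 2 * e1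
      - 2 * (2 * x + 2 * B₁) * e2 - hm - 2 * (2 * x + 2 * B₁) * hc
  · have e1 := hWo i (by omega) hi
    have e2 := hWe (i + 1) (by omega) hi.add_one
    rw [hi.neg_one_pow] at e3 e4
    rw [e4]
    push_cast at e2
    generalize ((i : ℕ) : F) = x at *
    subst hB
    linear_combination -2 * (2 * x + 2 + 2 * B₁) * e3 - 2 * (2 * x + 2 + 2 * B₁) * e1 + 2 * e2
      - hm + 2 * (2 * x + 2 + 2 * B₁) * hc

/-- Each pole carries one endpoint factor and one of the r's: ss(ss + 2r₁) at t = 1, which is t₀ if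
ss = 0, and (ss − 2(d + 1))(ss + 2r₂) at t = −1, which is t_d if ss = 2(d + 1). -/
theorem bilinearlyRelated_bannaiIto_even_iff {r₁ r₂ : F} (hd : 3 ≤ d) (hde : Even d)
    (ht : Function.Injective t) (hh : h ≠ 0) (h2 : (2 : F) ≠ 0)
    (hrel : r₁ + r₂ = -s - ss + d + 1) (hW0 : W 0 = 0) (hWd : W (d + 1) = 0)
    (htf : ∀ i : Fin (d + 1), t i = (1 - ss + 2 * ((i : ℕ) : F)) * (-1) ^ (i : ℕ))
    (haf : ∀ i : Fin (d + 1), a i - W i + W (i + 1) =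
      θ₀ + h * (s - 1 + (1 - s + 2 * ((i : ℕ) : F)) * (-1) ^ (i : ℕ)))
    (hne : ∀ k : ℕ, 1 ≤ k → k ≤ d → 2 * (k : F) - ss ≠ 0)
    (hWe : ∀ k : ℕ, k ≤ d + 1 → Even k → W k * (2 * k - ss) = -2 * h * (k + 0) * (k + r₁))
    (hWo : ∀ k : ℕ, k ≤ d + 1 → Odd k →
      W k * (2 * k - ss) = 2 * h * (k + (-d - 1)) * (k + r₂)) :
    BilinearlyRelated a t ↔ ss = -2 * r₁ ∨ ss = -2 * r₂ := by
  have hsum : 0 + r₁ + (-d - 1) + r₂ = -s - ss := by linear_combination hrel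
  constructor
  · intro hrelated
    by_contra! hcon
    have hr1 : ss + 2 * r₁ ≠ 0 := fun h0 => hcon.1 (by linear_combination h0)
    have hr2 : ss + 2 * r₂ ≠ 0 := fun h0 => hcon.2 (by linear_combination h0)
    obtain ⟨m, hm⟩ : ∃ m, 2 * m =
        -h * ((ss + 2 * 0) * (ss + 2 * r₁) + (ss + 2 * (-d - 1)) * (ss + 2 * r₂)) :=
      ⟨_ / 2, mul_div_cancel₀ _ h2⟩
    obtain ⟨ρ, hρ⟩ : ∃ ρ, 2 * ρ =
        -h * ((ss + 2 * 0) * (ss + 2 * r₁) - (ss + 2 * (-d - 1)) * (ss + 2 * r₂)) :=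
      ⟨_ / 2, mul_div_cancel₀ _ h2⟩
    have hP := bannaiIto_partial_fractions h2 hsum htf haf hWe hWo hm hρ
    refine not_bilinearlyRelated_of_two_poles hd ht hP ?_ ?_
      (hrelated.affine (b := 0) (c := θ₀ - h + h * s) (g := 1) (fun i => by ring) one_ne_zero
        fun i => by ring)
    · by_cases hs0 : ss = 0
      · subst hs0
        refine Or.inr ⟨0, by rw [htf]; simp, fun e => ?_⟩
        have e1 := haf 0
        have e2 := hWo 1 (by omega) odd_one
        simp only [Fin.val_zero, hW0, zero_add, Nat.cast_zero, pow_zero] at e1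
        push_cast at e2
        refine mul_ne_zero (mul_ne_zero hh h2) hr1 ?_
        linear_combination 2 * e + hm - 4 * e1 + 2 * e2 + 4 * h * hrel
      · left
        intro e
        refine mul_ne_zero (mul_ne_zero hh hs0) hr1 ?_
        apply mul_left_cancel₀ h2
        linear_combination -2 * e + hm + hρ
    · by_cases hs0 : ss + 2 * (-d - 1) = 0
      · obtain rfl : ss = 2 * (d + 1) := by linear_combination hs0
        refine Or.inr ⟨Fin.last d, ?_, fun e => ?_⟩
        · rw [htf, Fin.val_last, hde.neg_one_pow]; ring
        have e1 := haf (Fin.last d)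
        have e2 := hWe d (by omega) hde
        simp only [Fin.val_last, hWd, hde.neg_one_pow] at e1
        refine mul_ne_zero (mul_ne_zero hh h2) hr2 ?_
        linear_combination -2 * e - hm - 4 * e1 + 2 * e2 + 4 * h * hrel
      · left
        intro e
        refine mul_ne_zero (mul_ne_zero hh hs0) hr2 ?_
        apply mul_left_cancel₀ h2
        linear_combination 2 * e + hm - hρ
  · rintro (hr | hr)
    · refine bilinearlyRelated_of_even_linear (A₁ := r₁) (A₂ := 0) h2
        (by linear_combination hsum) hr htf haf (fun k hk hke => ?_) hWo
      rcases Nat.eq_zero_or_pos k with rfl | hk0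
      · rw [hW0]; simp
      have hk1 : k ≤ d := by
        rcases Nat.eq_or_lt_of_le hk with rfl | hk1
        · exact absurd hke (Nat.not_even_iff_odd.2 hde.add_one)
        · omega
      apply mul_left_cancel₀ (hne k hk0 hk1)
      linear_combination hWe k hk hke - h * k * hr
    · refine bilinearlyRelated_of_odd_linear (B₁ := r₂) (B₂ := -d - 1) h2
        (by linear_combination hsum) hr htf haf hWe (fun k hk hko => ?_)
      rcases Nat.eq_or_lt_of_le hk with rfl | hk1
      · rw [hWd]; push_cast; ring
      apply mul_left_cancel₀ (hne k hko.pos (by omega))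
      linear_combination hWo k hk hko + h * (k + (-d - 1)) * hr

/-- Both endpoint factors now belong to the pole t = 1, and r₁, r₂ both to t = −1. So only the pole
−1 can be removable, and r₁, r₂ play symmetric roles. -/
theorem bilinearlyRelated_bannaiIto_odd_iff {r₁ r₂ : F} (hd : 3 ≤ d) (hdo : Odd d)
    (ht : Function.Injective t) (hh : h ≠ 0) (h2 : (2 : F) ≠ 0)
    (hrel : r₁ + r₂ = -s - ss + d + 1) (hd₁ : (ss = 0 ∨ ss = 2 * (d + 1)) → (d : F) + 1 ≠ 0)
    (hW0 : W 0 = 0) (hWd : W (d + 1) = 0)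
    (htf : ∀ i : Fin (d + 1), t i = (1 - ss + 2 * ((i : ℕ) : F)) * (-1) ^ (i : ℕ))
    (haf : ∀ i : Fin (d + 1), a i - W i + W (i + 1) =
      θ₀ + h * (s - 1 + (1 - s + 2 * ((i : ℕ) : F)) * (-1) ^ (i : ℕ)))
    (hne : ∀ k : ℕ, 1 ≤ k → k ≤ d → 2 * (k : F) - ss ≠ 0)
    (hWe : ∀ k : ℕ, k ≤ d + 1 → Even k →
      W k * (2 * k - ss) = -2 * h * (k + 0) * (k + (-d - 1)))
    (hWo : ∀ k : ℕ, k ≤ d + 1 → Odd k → W k * (2 * k - ss) = 2 * h * (k + r₁) * (k + r₂)) :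
    BilinearlyRelated a t ↔ ss = -2 * r₁ ∨ ss = -2 * r₂ := by
  have hsum : 0 + (-d - 1) + r₁ + r₂ = -s - ss := by linear_combination hrel
  constructor
  · intro hrelated
    by_contra! hcon
    have hr1 : ss + 2 * r₁ ≠ 0 := fun h0 => hcon.1 (by linear_combination h0)
    have hr2 : ss + 2 * r₂ ≠ 0 := fun h0 => hcon.2 (by linear_combination h0)
    obtain ⟨m, hm⟩ : ∃ m, 2 * m =
        -h * ((ss + 2 * 0) * (ss + 2 * (-d - 1)) + (ss + 2 * r₁) * (ss + 2 * r₂)) :=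
      ⟨_ / 2, mul_div_cancel₀ _ h2⟩
    obtain ⟨ρ, hρ⟩ : ∃ ρ, 2 * ρ =
        -h * ((ss + 2 * 0) * (ss + 2 * (-d - 1)) - (ss + 2 * r₁) * (ss + 2 * r₂)) :=
      ⟨_ / 2, mul_div_cancel₀ _ h2⟩
    have hP := bannaiIto_partial_fractions h2 hsum htf haf hWe hWo hm hρ
    refine not_bilinearlyRelated_of_two_poles hd ht hP ?_ ?_
      (hrelated.affine (b := 0) (c := θ₀ - h + h * s) (g := 1) (fun i => by ring) one_ne_zero
        fun i => by ring)
    · by_cases hs0 : ss = 0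
      · subst hs0
        refine Or.inr ⟨0, by rw [htf]; simp, fun e => ?_⟩
        have e1 := haf 0
        have e2 := hWo 1 (by omega) odd_one
        simp only [Fin.val_zero, hW0, zero_add, Nat.cast_zero, pow_zero] at e1
        push_cast at e2
        refine mul_ne_zero (mul_ne_zero (mul_ne_zero hh h2) h2) (hd₁ (Or.inl rfl)) ?_
        linear_combination -2 * e - hm + 4 * e1 - 2 * e2 - 4 * h * hrel
      by_cases hs1 : ss + 2 * (-d - 1) = 0
      · obtain rfl : ss = 2 * (d + 1) := by linear_combination hs1
        refine Or.inr ⟨Fin.last d, ?_, fun e => ?_⟩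
        · rw [htf, Fin.val_last, hdo.neg_one_pow]; ring
        have e1 := haf (Fin.last d)
        have e2 := hWo d (by omega) hdo
        simp only [Fin.val_last, hWd, hdo.neg_one_pow] at e1
        refine mul_ne_zero (mul_ne_zero (mul_ne_zero hh h2) h2) (hd₁ (Or.inr rfl)) ?_
        linear_combination -2 * e - hm + 4 * e1 - 2 * e2 + 4 * h * hrel
      · left
        intro e
        refine mul_ne_zero (mul_ne_zero hh hs0) hs1 ?_
        apply mul_left_cancel₀ h2
        linear_combination -2 * e + hm + hρ
    · left
      intro e
      refine mul_ne_zero (mul_ne_zero hh hr1) hr2 ?_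
      apply mul_left_cancel₀ h2
      linear_combination 2 * e + hm - hρ
  · have key : ∀ r₁' r₂', ss = -2 * r₁' → r₁ + r₂ = r₁' + r₂' → r₁ * r₂ = r₁' * r₂' →
        BilinearlyRelated a t := by
      intro r₁' r₂' hr hadd hmul
      refine bilinearlyRelated_of_odd_linear (B₁ := r₁') (B₂ := r₂') h2
        (by linear_combination hsum - hadd) hr htf haf hWe (fun k hk hko => ?_)
      have hk1 : k ≤ d := by
        rcases Nat.eq_or_lt_of_le hk with rfl | hk1
        · exact absurd hko (Nat.not_odd_iff_even.2 hdo.add_one)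
        · omega
      apply mul_left_cancel₀ (hne k hko.pos hk1)
      linear_combination hWo k hk hko + 2 * h * (k * hadd + hmul) + h * (k + r₂') * hr
    rintro (hr | hr)
    · exact key r₁ r₂ hr rfl rfl
    · exact key r₂ r₁ hr (add_comm _ _) (mul_comm _ _)

end BannaiIto

/-! ### Translating the parameter arrays of the four types -/

namespace LeonardSystem

variable {F V : Type*} [Field F] [AddCommGroup V] [Module F V] {d : ℕ}
  {Φ : LeonardSystem F V d} {θ θs : Fin (d + 1) → F} {φ ϕ : ℕ → F}

/-- No nonvanishing of s, r₁, r₂ is assumed, so the q-Hahn formulas are included as a degenerate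
case. -/
theorem IsParameterArray.zeroDiagonalSpace_ne_bot_iff_of_qRacah_formulas [IsAlgClosed F]
    (hd : 3 ≤ d) (hp : Φ.IsParameterArray θ θs φ ϕ) {q h hs s ss r₁ r₂ : F}
    (hq : q ≠ 0) (hh : h ≠ 0) (hhs : hs ≠ 0) (hss : ss ≠ 0)
    (hrel : r₁ * r₂ = s * ss * q ^ (d + 1)) (hq2 : q ^ 2 ≠ 1) (hssd : ss * q ^ (d + 1) ≠ 1)
    (hθ : ∀ i : Fin (d + 1), θ i = θ 0 +
      h * (1 - q ^ (i : ℕ)) * (1 - s * q ^ ((i : ℕ) + 1)) * q ^ (-((i : ℕ) : ℤ)))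
    (hθs : ∀ i : Fin (d + 1), θs i = θs 0 +
      hs * (1 - q ^ (i : ℕ)) * (1 - ss * q ^ ((i : ℕ) + 1)) * q ^ (-((i : ℕ) : ℤ)))
    (hφ : ∀ i : ℕ, 1 ≤ i → i ≤ d → φ i =
      h * hs * q ^ (1 - 2 * (i : ℤ)) * (1 - q ^ i) * (1 - q ^ ((i : ℤ) - d - 1)) *
        (1 - r₁ * q ^ i) * (1 - r₂ * q ^ i)) :
    Φ.zeroDiagonalSpace ≠ ⊥ ↔ ss = r₁ ^ 2 ∨ ss = r₂ ^ 2 := by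
  obtain ⟨W, hW0, hWd, hW, ha⟩ := hp.exists_compression
  obtain ⟨hinj, -⟩ := exists_dual_eigenbasis hp.dualEigenvalue
  rw [zeroDiagonalSpace_ne_bot_iff (by omega) hp.dualEigenvalue ha]
  have hy0 : ∀ k : ℕ, q ^ k ≠ 0 := fun k => pow_ne_zero k hq
  let t : Fin (d + 1) → F := fun i => (q ^ (i : ℕ))⁻¹ + ss * q * q ^ (i : ℕ)
  have hθs' : ∀ i, θs i = (θs 0 - hs * (1 + ss * q)) + hs * t i := by
    intro i
    have hy := hy0 i
    rw [hθs i, zpow_neg, zpow_natCast, pow_succ]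
    simp only [t]
    field_simp
    ring
  have hdiff : ∀ (k : ℕ) (hk : k < d), (θs ⟨k + 1, by omega⟩ - θs ⟨k, by omega⟩) * q ^ (k + 1) =
      hs * (1 - q) * (1 - ss * (q ^ (k + 1)) ^ 2) := by
    intro k hk
    have hy := hy0 k
    rw [hθs', hθs' ⟨k, _⟩]
    simp only [t, pow_succ q k]
    field_simp
    ring
  rw [bilinearlyRelated_affine_iff (a' := fun i => (θ i + W i - W (i + 1)) -
    (θ 0 - h * (1 + s * q))) (fun i => (sub_add_cancel _ _).symm) hhs hθs']
  refine bilinearlyRelated_qRacah_iff hd ?_ hq hh hss hrel hq2 hssd hW0 hWd ?_ ?_ ?_ ?_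
  · intro i j hij
    apply hinj
    rw [hθs', hθs' j, hij]
  · intro i
    have hy := hy0 i
    simp only [t]
    field_simp
  · intro i
    have hy := hy0 i
    rw [hθ i, zpow_neg, zpow_natCast, pow_succ]
    field_simp
    ring
  · rintro (_ | k) hk1 hk2 h0
    · omega
    have h1 := hdiff k (by omega)
    rw [h0, mul_zero] at h1
    have h2 := hinj (sub_eq_zero.1 ((mul_eq_zero.1 h1).resolve_right (hy0 _)))
    simp at h2
  · rintro (_ | k) hk
    · rw [hW0]; simp
    rcases Nat.eq_or_lt_of_le hk with hk1 | hk1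
    · rw [hk1, hWd, inv_mul_cancel₀ (hy0 _)]; simp
    have h1 := hdiff k (by omega)
    have h2 := hW k (by omega)
    rw [hφ (k + 1) (by omega) (by omega)] at h2
    have h3 : q ^ (1 - 2 * ((k + 1 : ℕ) : ℤ)) = q * ((q ^ (k + 1)) ^ 2)⁻¹ := by
      rw [zpow_sub₀ hq, zpow_one, mul_comm 2, zpow_mul, zpow_natCast, div_eq_mul_inv]
      norm_cast
    have h4 : q ^ (((k + 1 : ℕ) : ℤ) - d - 1) = (q ^ (d + 1))⁻¹ * q ^ (k + 1) := by
      rw [sub_sub, zpow_sub₀ hq, zpow_natCast, div_eq_mul_inv, mul_comm]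
      norm_cast
    rw [h3, h4] at h2
    have hy := hy0 (k + 1)
    generalize q ^ (k + 1) = y at *
    generalize (q ^ (d + 1))⁻¹ = ε at *
    apply mul_left_cancel₀ hhs
    have h5 : y ^ 2 * (y ^ 2)⁻¹ = 1 := mul_inv_cancel₀ (pow_ne_zero 2 hy)
    linear_combination y ^ 2 * h2 - W (k + 1) * y * h1 + h * hs * q * (1 - y) * (1 - ε * y) *
      (1 - r₁ * y) * (1 - r₂ * y) * h5

theorem HasQRacahType.zeroDiagonalSpace_ne_bot_iff [IsAlgClosed F] (hd : 3 ≤ d)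
    {q h hs s ss r₁ r₂ : F} (H : Φ.HasQRacahType q h hs s ss r₁ r₂) :
    Φ.zeroDiagonalSpace ≠ ⊥ ↔ ss = r₁ ^ 2 ∨ ss = r₂ ^ 2 := by
  obtain ⟨hq, hh, hhs, -, hss, -, -⟩ := H.ne_zero
  obtain ⟨θ, θs, φ, ϕ, hp, hθ, hθs, hφ, -⟩ := H.array
  exact hp.zeroDiagonalSpace_ne_bot_iff_of_qRacah_formulas hd hq hh hhs hss H.rel
    (H.ne_one 2 (by omega) (by omega)).1 (H.ne_one' (d + 1) (by omega) (by omega)).2 hθ hθs hφ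

theorem HasQHahnType.zeroDiagonalSpace_ne_bot_iff [IsAlgClosed F] (hd : 3 ≤ d)
    {q h hs ss r : F} (H : Φ.HasQHahnType q h hs ss r) :
    Φ.zeroDiagonalSpace ≠ ⊥ ↔ ss = r ^ 2 := by
  obtain ⟨hq, hh, hhs, hss, -⟩ := H.ne_zero
  obtain ⟨θ, θs, φ, ϕ, hp, hθ, hθs, hφ, -⟩ := H.array
  rw [hp.zeroDiagonalSpace_ne_bot_iff_of_qRacah_formulas (s := 0) (r₁ := r) (r₂ := 0) hd hq hh hhs
    hss (by simp) (H.ne_one 2 (by omega) (by omega)).1 (H.ne_one' (d + 1) (by omega) (by omega))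
    (by simpa using hθ) hθs (by simpa using hφ)]
  -- The alternative ss = r₂² reads ss = 0 and is excluded.
  simp [hss]

theorem HasRacahType.zeroDiagonalSpace_ne_bot_iff (hd : 3 ≤ d) {h hs s ss r₁ r₂ : F}
    (H : Φ.HasRacahType h hs s ss r₁ r₂) :
    Φ.zeroDiagonalSpace ≠ ⊥ ↔ ss = 2 * r₁ ∨ ss = 2 * r₂ := by
  obtain ⟨hh, hhs⟩ := H.ne_zero
  obtain ⟨θ, θs, φ, ϕ, hp, hθ, hθs, hφ, -⟩ := H.array
  obtain ⟨W, hW0, hWd, hW, ha⟩ := hp.exists_compression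
  obtain ⟨hinj, -⟩ := exists_dual_eigenbasis hp.dualEigenvalue
  rw [LeonardSystem.zeroDiagonalSpace_ne_bot_iff (by omega) hp.dualEigenvalue ha]
  have h2 : (2 : F) ≠ 0 := by
    intro h0
    have h1 : ringChar F ∣ 2 := ringChar.dvd (by exact_mod_cast h0)
    rcases H.char with hc | ⟨-, hc⟩
    · rw [hc] at h1; simp at h1
    · have := Nat.le_of_dvd (by norm_num) h1; omega
  -- The characteristic may equal d + 1, but then either endpoint value of ss equals −(d + 1), which
  -- the type forbids.
  have hd₁ : (ss = 0 ∨ ss = -2 * (d + 1)) → (d : F) + 1 ≠ 0 := by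
    intro h1 h0
    apply (H.ne_neg' (d + 1) (by omega) (by omega)).2
    push_cast
    rcases h1 with h1 | h1 <;> rw [h1, h0] <;> simp
  let t : Fin (d + 1) → F := fun i => ((i : ℕ) : F) * ((i : ℕ) + 1 + ss)
  have hθs' : ∀ i, θs i = θs 0 + hs * t i := by
    intro i
    rw [hθs i, mul_assoc]
  have hdiff : ∀ (k : ℕ) (hk : k < d), θs ⟨k + 1, by omega⟩ - θs ⟨k, by omega⟩ =
      hs * (2 * (k + 1 : ℕ) + ss) := by
    intro k hk
    rw [hθs', hθs' ⟨k, _⟩]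
    simp only [t]
    push_cast
    ring
  rw [bilinearlyRelated_affine_iff (a' := fun i => θ i + W i - W (i + 1)) (c := 0)
    (fun i => (add_zero _).symm) hhs hθs']
  refine bilinearlyRelated_racah_iff (θ₀ := θ 0) hd ?_ hh h2 H.rel hd₁ hW0 hWd (fun i => rfl)
    ?_ ?_ ?_
  · intro i j hij
    apply hinj
    rw [hθs', hθs' j, hij]
  · intro i
    rw [hθ i]
    ring
  · rintro (_ | k) hk1 hk2 h0
    · omega
    have h1 := hdiff k (by omega)
    rw [h0, mul_zero] at h1
    simpa using hinj (sub_eq_zero.1 h1)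
  · rintro (_ | k) hk
    · rw [hW0]; simp
    rcases Nat.eq_or_lt_of_le hk with hk1 | hk1
    · rw [hk1, hWd]; push_cast; ring
    have h1 := hW k (by omega)
    rw [hφ (k + 1) (by omega) (by omega), hdiff k (by omega)] at h1
    apply mul_left_cancel₀ hhs
    linear_combination h1

theorem HasBannaiItoType.zeroDiagonalSpace_ne_bot_iff (hd : 3 ≤ d) {h hs s ss r₁ r₂ : F}
    (H : Φ.HasBannaiItoType h hs s ss r₁ r₂) :
    Φ.zeroDiagonalSpace ≠ ⊥ ↔ ss = -2 * r₁ ∨ ss = -2 * r₂ := by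
  obtain ⟨hh, hhs⟩ := H.ne_zero
  obtain ⟨θ, θs, φ, ϕ, hp, hθ, hθs, hφ, -⟩ := H.array
  obtain ⟨W, hW0, hWd, hW, ha⟩ := hp.exists_compression
  obtain ⟨hinj, -⟩ := exists_dual_eigenbasis hp.dualEigenvalue
  rw [LeonardSystem.zeroDiagonalSpace_ne_bot_iff (by omega) hp.dualEigenvalue ha]
  have h2 : (2 : F) ≠ 0 := by
    intro h0
    have h1 : ringChar F ∣ 2 := ringChar.dvd (by exact_mod_cast h0)
    rcases H.char with hc | ⟨hc, hodd, -⟩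
    · rw [hc] at h1; simp at h1
    · rw [(Nat.prime_dvd_prime_iff_eq hc Nat.prime_two).1 h1] at hodd
      exact absurd hodd (by decide)
  let t : Fin (d + 1) → F := fun i => (1 - ss + 2 * ((i : ℕ) : F)) * (-1) ^ (i : ℕ)
  have hθs' : ∀ i, θs i = (θs 0 + hs * (ss - 1)) + hs * t i := by
    intro i
    rw [hθs i]
    ring
  have hdiff : ∀ (k : ℕ) (hk : k < d), θs ⟨k + 1, by omega⟩ - θs ⟨k, by omega⟩ =
      2 * hs * (2 * (k + 1 : ℕ) - ss) * (-1) ^ (k + 1) := by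
    intro k hk
    rw [hθs', hθs' ⟨k, _⟩]
    simp only [t, pow_succ]
    push_cast
    ring
  have hne : ∀ k : ℕ, 1 ≤ k → k ≤ d → 2 * (k : F) - ss ≠ 0 := by
    intro k hk1 hk2 h0
    exact (H.ne_two_mul k hk1 hk2).2 (by linear_combination -h0)
  have ht : Function.Injective t := by
    intro i j hij
    apply hinj
    rw [hθs', hθs' j, hij]
  have haf : ∀ i : Fin (d + 1), (θ i + W i - W (i + 1)) - W i + W (i + 1) =
      θ 0 + h * (s - 1 + (1 - s + 2 * ((i : ℕ) : F)) * (-1) ^ (i : ℕ)) := by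
    intro i
    rw [hθ i]
    ring
  -- Consecutive dual eigenvalues differ by 2hs(2k − ss)(−1)ᵏ; the sign is why even and odd k are
  -- treated separately.
  have hWe : ∀ k : ℕ, 1 ≤ k → k ≤ d → Even k → W k * (2 * k - ss) * (2 * hs) = φ k := by
    rintro (_ | k) hk1 hk2 hk
    · omega
    rw [← hW k (by omega), hdiff k (by omega), hk.neg_one_pow]
    ring
  have hWo : ∀ k : ℕ, 1 ≤ k → k ≤ d → Odd k → W k * (2 * k - ss) * (2 * hs) = -φ k := by
    rintro (_ | k) hk1 hk2 hk
    · omega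
    rw [← hW k (by omega), hdiff k (by omega), hk.neg_one_pow]
    ring
  have h2hs : 2 * hs ≠ 0 := mul_ne_zero h2 hhs
  rw [bilinearlyRelated_affine_iff (a' := fun i => θ i + W i - W (i + 1)) (c := 0)
    (fun i => (add_zero _).symm) hhs hθs']
  rcases Nat.even_or_odd d with hde | hdo
  · refine bilinearlyRelated_bannaiIto_even_iff hd hde ht hh h2 H.rel hW0 hWd (fun i => rfl) haf
      hne (fun k hk hke => ?_) (fun k hk hko => ?_)
    · rcases Nat.eq_zero_or_pos k with rfl | hk0
      · rw [hW0]; simp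
      rcases Nat.eq_or_lt_of_le hk with rfl | hk1
      · exact absurd hke (Nat.not_even_iff_odd.2 hde.add_one)
      apply mul_right_cancel₀ h2hs
      rw [hWe k hk0 (by omega) hke, (hφ k hk0 (by omega)).1 hke hde]
      ring
    · rcases Nat.eq_or_lt_of_le hk with rfl | hk1
      · rw [hWd]; push_cast; ring
      apply mul_right_cancel₀ h2hs
      rw [hWo k hko.pos (by omega) hko, (hφ k hko.pos (by omega)).2.1 hko hde]
      ring
  · have hd₁ : (ss = 0 ∨ ss = 2 * (d + 1)) → (d : F) + 1 ≠ 0 := by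
      intro h1 h0
      obtain ⟨k, hk⟩ := hdo
      -- Since d is odd, d + 1 = 2(k + 1) with k + 1 ≤ d, so ss = d + 1 is a forbidden value. If d +
      -- 1 = 0 in the field, both endpoint values of ss coincide with it.
      apply (H.ne_two_mul (k + 1) (by omega) (by omega)).2
      rw [hk] at h0 h1
      push_cast at h0 h1 ⊢
      rcases h1 with h1 | h1
      · rw [h1]; linear_combination -h0
      · rw [h1]; linear_combination h0
    refine bilinearlyRelated_bannaiIto_odd_iff hd hdo ht hh h2 H.rel hd₁ hW0 hWd (fun i => rfl) haf
      hne (fun k hk hke => ?_) (fun k hk hko => ?_)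
    · rcases Nat.eq_zero_or_pos k with rfl | hk0
      · rw [hW0]; simp
      rcases Nat.eq_or_lt_of_le hk with rfl | hk1
      · rw [hWd]; push_cast; ring
      apply mul_right_cancel₀ h2hs
      rw [hWe k hk0 (by omega) hke, (hφ k hk0 (by omega)).2.2.1 hke hdo]
      ring
    · have hk1 : k ≤ d := by
        rcases Nat.eq_or_lt_of_le hk with rfl | hk1
        · exact absurd hko (Nat.not_odd_iff_even.2 hdo.add_one)
        · omega
      apply mul_right_cancel₀ h2hs
      rw [hWo k hko.pos hk1 hko, (hφ k hko.pos hk1).2.2.2 hko hdo]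
      ring

end LeonardSystem

theorem theorem9p3 {F V : Type*} [Field F] [IsAlgClosed F] [AddCommGroup V] [Module F V]
    [FiniteDimensional F V] {d : ℕ} (hd : 3 ≤ d) (Φ : LeonardSystem F V d) :
    (∀ q h hs s ss r₁ r₂ : F, Φ.HasQRacahType q h hs s ss r₁ r₂ →
      (Φ.zeroDiagonalSpace ≠ ⊥ ↔ ss = r₁ ^ 2 ∨ ss = r₂ ^ 2)) ∧
    (∀ q h hs ss r : F, Φ.HasQHahnType q h hs ss r →
      (Φ.zeroDiagonalSpace ≠ ⊥ ↔ ss = r ^ 2)) ∧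
    (∀ h hs s ss r₁ r₂ : F, Φ.HasRacahType h hs s ss r₁ r₂ →
      (Φ.zeroDiagonalSpace ≠ ⊥ ↔ ss = 2 * r₁ ∨ ss = 2 * r₂)) ∧
    (∀ h hs s ss r₁ r₂ : F, Φ.HasBannaiItoType h hs s ss r₁ r₂ →
      (Φ.zeroDiagonalSpace ≠ ⊥ ↔ ss = -2 * r₁ ∨ ss = -2 * r₂)) :=
  ⟨fun _ _ _ _ _ _ _ H => H.zeroDiagonalSpace_ne_bot_iff hd,
    fun _ _ _ _ _ H => H.zeroDiagonalSpace_ne_bot_iff hd,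
    fun _ _ _ _ _ _ H => H.zeroDiagonalSpace_ne_bot_iff hd,
    fun _ _ _ _ _ _ H => H.zeroDiagonalSpace_ne_bot_iff hd⟩
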